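/- Let $n,d,N\ge 0$ be integers and let the set $\{1,\dots,N\}$ of column indices be split into pairwise disjoint sets $I_1,\dots,I_{n+1}$ with union $\{1,\dots,N\}$, where $d_i=|I_i|\ge d$ for all $i$ (so $N=d_1+\cdots+d_{n+1}\ge d$). For $u\in SU(N)$ let $W^{(i)}$ be the $d\times d_i$ matrix formed by the entries of $u$ in its first $d$ rows and in the columns with index in $I_i$, and put $Z^{(i)}=W^{(i)}(W^{(i)})^*$. The matrix-extracting procedure is the map $u\mapsto (Z^{(1)},\dots,Z^{(n)})$. For $a=(a_1,\dots,a_{n+1})$ with all $a_i>0$, the matrix Dirichlet measure $D_a$ is the probability measure on the set of $n$-tuples of non-negative Hermitian $d\times d$ matrices with $\sum_{k=1}^n Z^{(k)}\le \mathrm{Id}$ given by $$C\prod_{k=1}^n\det(Z^{(k)})^{a_k-1}\,\det\Bigl(\mathrm{Id}-\sum_{k=1}^nZ^{(k)}\Bigr)^{a_{n+1}-1}\prod_{k=1}^n dZ^{(k)},$$ where $dZ=\prod_{p}dX_{pp}\prod_{p<q}dX_{pq}\,dY_{pq}$ for a Hermitian matrix with entries $Z_{pq}=X_{pq}+iY_{pq}$,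 and $C$ is the normalizing constant (the inverse of the total mass of the measure without $C$). Then, for $a_i=d_i-d+1$, the measure $D_a$ is well defined (that is, a probability measure after normalization), and the image of the normalized Haar measure on $SU(N)$ under the matrix-extracting procedure is the matrix Dirichlet measure $D_{d_1-d+1,\dots,d_{n+1}-d+1}$; that is, it has density $C\prod_{k=1}^n\det(Z^{(k)})^{d_k-d}\,\det(\mathrm{Id}-\sum_{k=1}^nZ^{(k)})^{d_{n+1}-d}$. -/

import Mathlib

open MeasureTheory Matrix
open scoped ComplexOrder

namespace MatrixDirichlet

noncomputable section

/-! ### Complex matrices as a Borel space, and Haar measure on `SU(N)` -/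

/-- The entrywise (product) measurable structure on complex matrices. -/
instance matrixMeasurableSpace (m n : Type*) : MeasurableSpace (Matrix m n ℂ) :=
  inferInstanceAs (MeasurableSpace (m → n → ℂ))

instance matrixBorelSpace (m n : Type*) [Finite m] [Finite n] : BorelSpace (Matrix m n ℂ) :=
  have := Fintype.ofFinite m
  have := Fintype.ofFinite n
  inferInstanceAs (BorelSpace (m → n → ℂ))

/-- The special unitary group `SU(N)`. -/
abbrev SU (N : ℕ) : Type := specialUnitaryGroup (Fin N) ℂ

instance isTopologicalGroup_SU (N : ℕ) : IsTopologicalGroup (SU N) where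
  continuous_inv := by
    have h : Continuous fun A : SU N => star (A : Matrix (Fin N) (Fin N) ℂ) :=
      continuous_subtype_val.star
    exact h.subtype_mk _

instance compactSpace_SU (N : ℕ) : CompactSpace (SU N) := by
  refine isCompact_iff_compactSpace.mp ?_
  have hK : IsCompact (Set.univ.pi fun _ : Fin N => Set.univ.pi fun _ : Fin N =>
      Metric.closedBall (0 : ℂ) 1) :=
    isCompact_univ_pi fun _ => isCompact_univ_pi fun _ => isCompact_closedBall 0 1
  refine IsCompact.of_isClosed_subset (X := Matrix (Fin N) (Fin N) ℂ) hK ?_ ?_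
  · have h1 : IsClosed {A : Matrix (Fin N) (Fin N) ℂ | A * star A = 1} :=
      isClosed_eq (continuous_id.mul continuous_id.star) continuous_const
    have h2 : IsClosed {A : Matrix (Fin N) (Fin N) ℂ | A.det = 1} :=
      isClosed_eq continuous_id.matrix_det continuous_const
    convert h1.inter h2 using 1
    ext A
    simp [mem_specialUnitaryGroup_iff, mem_unitaryGroup_iff]
  · intro A hA i _ j _
    simpa using entry_norm_bound_of_unitary (mem_specialUnitaryGroup_iff.mp hA).1 i j

/-- The Haar measure on `SU(N)`, normalised to be a probability measure. -/
def haarSU (N : ℕ) : Measure (SU N) := Measure.haarMeasure ⊤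

/-! ### The matrix-extracting procedure -/

/-- The extracted matrix `W`, of size `d × |J|`: the first `d` rows of `u`, and its columns with
index in `J`. -/
def extractedBlock {d N : ℕ} (h : d ≤ N) (J : Finset (Fin N)) (u : SU N) :
    Matrix (Fin d) J ℂ :=
  (u : Matrix (Fin N) (Fin N) ℂ).submatrix (Fin.castLE h) Subtype.val

/-- The matrix-extracting procedure: from `u ∈ SU(N)` and the sets `I 0, …, I n` of columns, form
`Z⁽ⁱ⁾ = W⁽ⁱ⁾ W⁽ⁱ⁾*` and keep the first `n` of these `n + 1` matrices. -/
def extract {n d N : ℕ} (h : d ≤ N) (I : Fin (n + 1) → Finset (Fin N)) (u : SU N) :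
    Fin n → Matrix (Fin d) (Fin d) ℂ :=
  fun k => extractedBlock h (I k.castSucc) u * (extractedBlock h (I k.castSucc) u)ᴴ

/-! ### Matrix Dirichlet measures -/

/-- Real coordinates of a `d × d` Hermitian matrix: the real diagonal entries and the complex
entries strictly above the diagonal. -/
abbrev HermCoord (d : ℕ) : Type := (Fin d → ℝ) × ({p : Fin d × Fin d // p.1 < p.2} → ℂ)

/-- The Hermitian matrix with the given coordinates. -/
def hermOf {d : ℕ} (c : HermCoord d) : Matrix (Fin d) (Fin d) ℂ :=
  Matrix.of fun p q =>
    if h : p < q then c.2 ⟨(p, q), h⟩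
    else if h : q < p then star (c.2 ⟨(q, p), h⟩)
    else (c.1 p : ℂ)

/-- Lebesgue measure `∏ₖ dZ⁽ᵏ⁾` on `n`-tuples of `d × d` Hermitian matrices, where `dZ` is the
product of the `dX_pp` and of the `dX_pq dY_pq` for `p < q`, with `Z_pq = X_pq + i Y_pq`; it is
seen as a measure on `n`-tuples of complex matrices, carried by the Hermitian ones. -/
def hermLebesgue (n d : ℕ) : Measure (Fin n → Matrix (Fin d) (Fin d) ℂ) :=
  Measure.map (fun c : Fin n → HermCoord d => fun k => hermOf (c k)) volume

/-- The complex matrix simplex: `n`-tuples of non-negative Hermitian `d × d` matrices whose sum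
is at most the identity. -/
def matrixSimplex (n d : ℕ) : Set (Fin n → Matrix (Fin d) (Fin d) ℂ) :=
  {Z | (∀ k, (Z k).PosSemidef) ∧ (1 - ∑ k, Z k).PosSemidef}

/-- The density `∏ₖ det(Z⁽ᵏ⁾) ^ (aₖ - 1) * det(Id - ∑ₖ Z⁽ᵏ⁾) ^ (aₙ₊₁ - 1)`. On the simplex these
determinants are non-negative reals. -/
def dirichletWeight {n d : ℕ} (a : Fin (n + 1) → ℝ) (Z : Fin n → Matrix (Fin d) (Fin d) ℂ) : ℝ :=
  (∏ k : Fin n, (Z k).det.re ^ (a k.castSucc - 1)) *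
    (1 - ∑ k, Z k).det.re ^ (a (Fin.last n) - 1)

/-- The matrix Dirichlet measure before normalisation. -/
def dirichletUnnormalized (n d : ℕ) (a : Fin (n + 1) → ℝ) :
    Measure (Fin n → Matrix (Fin d) (Fin d) ℂ) :=
  ((hermLebesgue n d).restrict (matrixSimplex n d)).withDensity
    fun Z => ENNReal.ofReal (dirichletWeight a Z)

/-- The matrix Dirichlet measure `D_a`: the normalising constant is the inverse of the total
mass. -/
def dirichlet (n d : ℕ) (a : Fin (n + 1) → ℝ) : Measure (Fin n → Matrix (Fin d) (Fin d) ℂ) :=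
  (dirichletUnnormalized n d a Set.univ)⁻¹ • dirichletUnnormalized n d a

end

end MatrixDirichlet

namespace MatrixDirichlet

/-! ### Determinants of multiplication maps, as real linear maps -/

/-! Let G be a d × N matrix under Lebesgue measure, with blocks of columns G_k, Gram matrices A_k =
G_k G_k* and S = ∑ A_k = G G*. With the weight exp(-tr S), the integral of h applied to the first n
matrices S^{-1/2} A_k S^{-1/2} is evaluated in two ways, for every measurable h ≥ 0.

On the one hand, S^{-1/2} G has orthonormal rows wherever S is invertible, and Lebesgue measure is
invariant under G ↦ G u for u in SU(N). Averaging over Haar-distributed u turns S^{-1/2} G into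
fixed orthonormal rows times u, which have the law of the first d rows of u. The result is the total
weight K times the integral of h against the extracted law (`lintegral_normalizedBlocks_gram`).

On the other hand, the image of Lebesgue measure under G_k ↦ A_k has density proportional to
det(A_k)^(d_k - d) on the cone (`exists_map_gram_volume`): the image and this density scale alike
under A ↦ T A T*, so their Laplace transforms are proportional, and these determine the measures.
Substituting A_k = S^{1/2} Z_k S^{1/2} then splits off S and leaves the unnormalized Dirichlet
integral of h (`exists_lintegral_normalizedBlocks`).

Since 0 < K < ∞, the Dirichlet mass is also positive and finite, and normalizing identifies the two
laws. No constant has to be computed. -/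

theorem det_real_toLin' {p : Type*} [Fintype p] [DecidableEq p] (T : Matrix p p ℂ) :
    LinearMap.det ((Matrix.toLin' T).restrictScalars ℝ) = ‖T.det‖ ^ 2 := by
  rw [LinearMap.det_restrictScalars, LinearMap.det_toLin', Algebra.norm_complex_apply,
    Complex.normSq_eq_norm_sq]

/-- Left multiplication by `T` acting on families of column vectors. -/
noncomputable def colMul {p : Type*} [Fintype p] (q : Type*) (T : Matrix p p ℂ) :
    (q → p → ℂ) →ₗ[ℝ] (q → p → ℂ) :=
  LinearMap.pi fun j => (T.mulVecLin.restrictScalars ℝ).comp (LinearMap.proj j)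

/-- The map is block diagonal, one block per column, and the real determinant of a complex linear
map is the squared modulus of its complex determinant. -/
theorem det_colMul {p q : Type*} [Fintype p] [DecidableEq p] [Fintype q] (T : Matrix p p ℂ) :
    LinearMap.det (colMul q T) = ‖T.det‖ ^ (2 * Fintype.card q) := by
  have h := LinearMap.det_pi (R := ℝ) (ι := q) fun _ => T.mulVecLin.restrictScalars ℝ
  rw [colMul, h]
  have := det_real_toLin' T
  rw [Matrix.toLin'_apply'] at this
  rw [this, Finset.prod_const, Finset.card_univ, ← pow_mul]

/-- Left multiplication by `T` on matrices, as a real linear map. -/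
noncomputable def mulLeftR {p : Type*} [Fintype p] (q : Type*) (T : Matrix p p ℂ) :
    Matrix p q ℂ →ₗ[ℝ] Matrix p q ℂ where
  toFun M := T * M
  map_add' := Matrix.mul_add T
  map_smul' c M := Matrix.mul_smul T c M

/-- Right multiplication by `U` on matrices, as a real linear map. -/
noncomputable def mulRightR {q : Type*} [Fintype q] (p : Type*) (U : Matrix q q ℂ) :
    Matrix p q ℂ →ₗ[ℝ] Matrix p q ℂ where
  toFun M := M * U
  map_add' A B := Matrix.add_mul A B U
  map_smul' c M := Matrix.smul_mul c M U

theorem det_mulLeftR {p q : Type*} [Fintype p] [DecidableEq p] [Fintype q] (T : Matrix p p ℂ) :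
    LinearMap.det (mulLeftR q T) = ‖T.det‖ ^ (2 * Fintype.card q) := by
  rw [← det_colMul (q := q) T]
  let e : Matrix p q ℂ ≃ₗ[ℝ] (q → p → ℂ) := Matrix.transposeLinearEquiv p q ℝ ℂ
  rw [← LinearMap.det_conj (mulLeftR q T) e]
  rfl

theorem det_mulRightR {p q : Type*} [Fintype q] [DecidableEq q] [Fintype p] (U : Matrix q q ℂ) :
    LinearMap.det (mulRightR p U) = ‖U.det‖ ^ (2 * Fintype.card p) := by
  rw [← Matrix.det_transpose, ← det_mulLeftR (q := p) Uᵀ]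
  rw [← LinearMap.det_conj (mulRightR p U) (Matrix.transposeLinearEquiv p q ℝ ℂ)]
  congr 1
  ext1 M
  simp [mulLeftR, mulRightR]

/-! ### Real coordinates on Hermitian matrices -/

variable {d : ℕ}

/-- The coordinates of a matrix, read off its diagonal and its strict upper triangle. -/
noncomputable def coords (M : Matrix (Fin d) (Fin d) ℂ) : HermCoord d :=
  (fun p => (M p p).re, fun pq => M pq.1.1 pq.1.2)

theorem coords_hermOf (c : HermCoord d) : coords (hermOf c) = c := by
  ext p
  · simp [coords, hermOf]
  · simp [coords, hermOf, p.2]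

theorem isHermitian_hermOf (c : HermCoord d) : (hermOf c).IsHermitian := by
  ext p q
  rcases lt_trichotomy p q with h | h | h
  · simp [hermOf, h, h.not_gt]
  · simp [hermOf, h]
  · simp [hermOf, h, h.not_gt]

theorem hermOf_coords {M : Matrix (Fin d) (Fin d) ℂ} (hM : M.IsHermitian) :
    hermOf (coords M) = M := by
  ext p q
  rcases lt_trichotomy p q with h | h | h
  · simp [hermOf, coords, h]
  · subst h
    simpa [hermOf, coords] using hM.coe_re_apply_self p
  · simpa [hermOf, coords, h, h.not_gt] using hM.apply p q

/-- `hermOf` as a real linear map. -/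
noncomputable def hermL (d : ℕ) : HermCoord d →ₗ[ℝ] Matrix (Fin d) (Fin d) ℂ where
  toFun := hermOf
  map_add' a b := by
    ext p q
    simp only [hermOf, Matrix.of_apply, Matrix.add_apply]
    split_ifs <;> simp
  map_smul' r a := by
    ext p q
    simp only [hermOf, Matrix.of_apply, Matrix.smul_apply]
    split_ifs <;> simp

/-- `coords` as a real linear map. -/
noncomputable def coordsL (d : ℕ) : Matrix (Fin d) (Fin d) ℂ →ₗ[ℝ] HermCoord d where
  toFun := coords
  map_add' a b := by ext <;> simp [coords]
  map_smul' r a := by ext <;> simp [coords]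

theorem hermL_apply (c : HermCoord d) : hermL d c = hermOf c := rfl

theorem hermOf_injective : Function.Injective (hermOf (d := d)) :=
  Function.LeftInverse.injective coords_hermOf

theorem continuous_hermOf : Continuous (hermOf (d := d)) := by
  refine continuous_matrix fun p q => ?_
  simp only [hermOf, Matrix.of_apply]
  split_ifs <;> fun_prop

theorem continuous_coords : Continuous (coords (d := d)) := by
  unfold coords
  fun_prop

/-- The action `A ↦ T A T*` on Hermitian matrices, in coordinates. -/
noncomputable def conjL (T : Matrix (Fin d) (Fin d) ℂ) : HermCoord d →ₗ[ℝ] HermCoord d :=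
  coordsL d ∘ₗ mulRightR (Fin d) Tᴴ ∘ₗ mulLeftR (Fin d) T ∘ₗ hermL d

theorem hermOf_conjL (T : Matrix (Fin d) (Fin d) ℂ) (c : HermCoord d) :
    hermOf (conjL T c) = T * hermOf c * Tᴴ :=
  hermOf_coords (isHermitian_mul_mul_conjTranspose T (isHermitian_hermOf c))

/-- Every complex matrix is uniquely `A + iB` with `A` and `B` Hermitian. -/
noncomputable def cartesian (d : ℕ) : (HermCoord d × HermCoord d) ≃ₗ[ℝ] Matrix (Fin d) (Fin d) ℂ where
  toFun c := hermOf c.1 + Complex.I • hermOf c.2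
  map_add' a b := by
    simp only [← hermL_apply, Prod.fst_add, Prod.snd_add, map_add, smul_add]
    abel
  map_smul' r a := by
    simp only [← hermL_apply, Prod.smul_fst, Prod.smul_snd, map_smul, smul_add, RingHom.id_apply]
    rw [smul_comm]
  invFun M := (coords ((2⁻¹ : ℂ) • (M + Mᴴ)), coords ((2⁻¹ * -Complex.I : ℂ) • (M - Mᴴ)))
  left_inv c := by
    have h1 := (isHermitian_hermOf c.1).eq
    have h2 := (isHermitian_hermOf c.2).eq
    ext1
    · refine (congrArg coords ?_).trans (coords_hermOf c.1)
      ext p q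
      simp [h1, h2]
      ring
    · refine (congrArg coords ?_).trans (coords_hermOf c.2)
      ext p q
      simp [h1, h2]
      linear_combination (-(hermOf c.2 p q)) * Complex.I_mul_I
  right_inv M := by
    have h1 : ((2⁻¹ : ℂ) • (M + Mᴴ)).IsHermitian := by
      ext p q
      simp [add_comm, mul_add]
    have h2 : ((2⁻¹ * -Complex.I : ℂ) • (M - Mᴴ)).IsHermitian := by
      ext p q
      simp
      ring
    simp only [hermOf_coords h1, hermOf_coords h2]
    ext p q
    simp
    linear_combination (-(1/2) * (M p q - (starRingEnd ℂ) (M q p))) * Complex.I_mul_I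

/-- Through M = A + iB, the map M ↦ T M T* on all complex matrices is two copies of the action on
Hermitian ones. Its determinant |det T|^(4d) is therefore the square of the one wanted, which
determines the latter up to sign. -/
theorem abs_det_conjL (T : Matrix (Fin d) (Fin d) ℂ) :
    |LinearMap.det (conjL T)| = ‖T.det‖ ^ (2 * d) := by
  have h : LinearMap.det (conjL T) ^ 2 = (‖T.det‖ ^ (2 * d)) ^ 2 := by
    rw [sq, ← LinearMap.det_prodMap, ← LinearMap.det_conj _ (cartesian d)]
    have : (cartesian d : _ →ₗ[ℝ] _) ∘ₗ ((conjL T).prodMap (conjL T)) ∘ₗ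
        ((cartesian d).symm : _ →ₗ[ℝ] _) = mulRightR (Fin d) Tᴴ ∘ₗ mulLeftR (Fin d) T := by
      ext1 M
      obtain ⟨c, rfl⟩ := (cartesian d).surjective M
      simp only [LinearMap.comp_apply, LinearEquiv.coe_coe, LinearEquiv.symm_apply_apply]
      change hermOf (conjL T c.1) + Complex.I • hermOf (conjL T c.2) =
        T * (hermOf c.1 + Complex.I • hermOf c.2) * Tᴴ
      simp [hermOf_conjL, mul_add, add_mul]
    rw [this, LinearMap.det_comp, det_mulRightR, det_mulLeftR, Matrix.det_conjTranspose]
    simp [sq]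
  rw [← abs_of_nonneg (by positivity : 0 ≤ ‖T.det‖ ^ (2 * d))]
  exact (sq_eq_sq_iff_abs_eq_abs _ _).mp h

end MatrixDirichlet

namespace MatrixDirichlet

/-! ### Finite measures with the same local moment generating functions -/

open ProbabilityTheory in
/-- Two real random variables whose moment generating functions are finite and agree near `0` have
complex moment generating functions which agree on the imaginary axis. -/
theorem complexMGF_mul_I_eq_of_mgf_eq_near_zero {Ω Ω' : Type*} {_ : MeasurableSpace Ω}
    {_ : MeasurableSpace Ω'} {μ : Measure Ω} {ν : Measure Ω'} {X : Ω → ℝ} {Y : Ω' → ℝ} {ε : ℝ}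
    (hε : 0 < ε) (hX : ∀ t ∈ Set.Ioo (-ε) ε, Integrable (fun ω => Real.exp (t * X ω)) μ)
    (hY : ∀ t ∈ Set.Ioo (-ε) ε, Integrable (fun ω => Real.exp (t * Y ω)) ν)
    (h : ∀ t ∈ Set.Ioo (-ε) ε, mgf X μ t = mgf Y ν t) (s : ℝ) :
    complexMGF X μ (s * Complex.I) = complexMGF Y ν (s * Complex.I) := by
  have hsubX : Set.Ioo (-ε) ε ⊆ interior (integrableExpSet X μ) :=
    interior_maximal (fun t ht => hX t ht) isOpen_Ioo
  have hsubY : Set.Ioo (-ε) ε ⊆ interior (integrableExpSet Y ν) :=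
    interior_maximal (fun t ht => hY t ht) isOpen_Ioo
  have aX : AnalyticOnNhd ℂ (complexMGF X μ) {z | z.re ∈ Set.Ioo (-ε) ε} :=
    analyticOnNhd_complexMGF.mono fun z hz => hsubX hz
  have aY : AnalyticOnNhd ℂ (complexMGF Y ν) {z | z.re ∈ Set.Ioo (-ε) ε} :=
    analyticOnNhd_complexMGF.mono fun z hz => hsubY hz
  have h0 : (0 : ℝ) ∈ Set.Ioo (-ε) ε := ⟨by linarith, hε⟩
  -- Identity theorem on the vertical strip |Re z| < ε: the two analytic functions agree at real
  -- points accumulating at 0.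
  refine AnalyticOnNhd.eqOn_of_preconnected_of_frequently_eq aX aY
    ((convex_Ioo (-ε) ε).linear_preimage Complex.reLm).isPreconnected
    (z₀ := ((0 : ℝ) : ℂ)) (by simpa using hε) ?_ (by simpa using hε)
  have hreal : ∃ᶠ x : ℝ in nhdsWithin 0 {0}ᶜ, complexMGF X μ x = complexMGF Y ν x := by
    refine Filter.Eventually.frequently ?_
    filter_upwards [nhdsWithin_le_nhds (isOpen_Ioo.mem_nhds h0)] with x hx
    rw [complexMGF_ofReal, complexMGF_ofReal, h x hx]
  have ht : Filter.Tendsto (fun x : ℝ => (x : ℂ)) (nhdsWithin 0 {0}ᶜ)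
      (nhdsWithin ((0 : ℝ) : ℂ) {((0 : ℝ) : ℂ)}ᶜ) := by
    refine tendsto_nhdsWithin_iff.mpr ⟨?_, ?_⟩
    · exact (Complex.continuous_ofReal.tendsto 0).mono_left nhdsWithin_le_nhds
    · filter_upwards [self_mem_nhdsWithin] with x hx
      simpa using hx
  exact ht.frequently hreal

/-- Finite measures on a finite-dimensional space are equal as soon as, for each linear form `ℓ`,
the Laplace transforms at `t • ℓ` are finite and agree for small `t`. -/
theorem measure_ext_of_lintegral_exp_eq {E : Type*} [NormedAddCommGroup E] [NormedSpace ℝ E]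
    [FiniteDimensional ℝ E] [MeasurableSpace E] [BorelSpace E] {μ ν : Measure E}
    [IsFiniteMeasure μ] [IsFiniteMeasure ν]
    (h : ∀ ℓ : E →L[ℝ] ℝ, ∃ ε > 0, ∀ t ∈ Set.Ioo (-ε) ε,
      ∫⁻ x, ENNReal.ofReal (Real.exp (t * ℓ x)) ∂μ ≠ ⊤ ∧
      ∫⁻ x, ENNReal.ofReal (Real.exp (t * ℓ x)) ∂μ = ∫⁻ x, ENNReal.ofReal (Real.exp (t * ℓ x)) ∂ν) :
    μ = ν := by
  have := FiniteDimensional.complete ℝ E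
  have : SecondCountableTopology E := by
    have := FiniteDimensional.proper ℝ E
    infer_instance
  refine Measure.ext_of_charFunDual (funext fun ℓ => ?_)
  obtain ⟨ε, hε, H⟩ := h ℓ
  have hint (ρ : Measure E) (t : ℝ) (hfin : ∫⁻ x, ENNReal.ofReal (Real.exp (t * ℓ x)) ∂ρ ≠ ⊤) :
      Integrable (fun x => Real.exp (t * ℓ x)) ρ := by
    refine ⟨by fun_prop, ?_⟩
    rw [hasFiniteIntegral_iff_ofReal (.of_forall fun x => (Real.exp_pos _).le)]
    exact hfin.lt_top
  -- The single point s = 1 suffices, because ℓ ranges over all linear forms.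
  have key := complexMGF_mul_I_eq_of_mgf_eq_near_zero (X := ℓ) (Y := ℓ) hε
    (fun t ht => hint μ t (H t ht).1) (fun t ht => hint ν t ((H t ht).2 ▸ (H t ht).1))
    (fun t ht => ?_) 1
  · simpa [ProbabilityTheory.complexMGF, charFunDual_apply, mul_comm] using key
  · rw [ProbabilityTheory.mgf, ProbabilityTheory.mgf,
      integral_eq_lintegral_of_nonneg_ae (.of_forall fun x => (Real.exp_pos _).le) (by fun_prop),
      integral_eq_lintegral_of_nonneg_ae (.of_forall fun x => (Real.exp_pos _).le) (by fun_prop),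
      (H t ht).2]

/-! ### Integrability of exponentially decaying functions -/

theorem exists_forall_exp_neg_mul_pow_le (a b : ℕ) :
    ∃ C : ℝ, ∀ x : ℝ, 0 ≤ x → Real.exp (-x) * (1 + x) ^ a ≤ C * (1 + x) ^ (-(b : ℝ)) := by
  -- The constant comes from the exponential series: (1 + x)^(a+b) / (a+b)! ≤ e^(1+x).
  refine ⟨(a + b).factorial * Real.exp 1, fun x hx => ?_⟩
  have h1 : 0 < 1 + x := by linarith
  have h := Real.pow_div_factorial_le_exp (1 + x) h1.le (a + b)
  rw [div_le_iff₀ (by positivity), Real.exp_add, pow_add] at h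
  rw [Real.rpow_neg h1.le, Real.rpow_natCast, Real.exp_neg, ← div_eq_mul_inv,
    le_div_iff₀ (by positivity), inv_mul_eq_div, div_mul_eq_mul_div, div_le_iff₀ (Real.exp_pos x)]
  linarith

/-- The exponential bound is dominated by a multiple of (1 + ‖x‖)^(-(dim E + 1)), which is
integrable. -/
theorem lintegral_ne_top_of_le_exp_neg_norm {E : Type*} [NormedAddCommGroup E] [NormedSpace ℝ E]
    [FiniteDimensional ℝ E] [MeasurableSpace E] [BorelSpace E] (μ : Measure E)
    [μ.IsAddHaarMeasure] {f : E → ENNReal} {C : ℝ} {a : ℕ}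
    (hf : ∀ x, f x ≤ ENNReal.ofReal (C * (Real.exp (-‖x‖) * (1 + ‖x‖) ^ a))) :
    ∫⁻ x, f x ∂μ ≠ ⊤ := by
  obtain ⟨D, hD⟩ := exists_forall_exp_neg_mul_pow_le a (Module.finrank ℝ E + 1)
  have hi : Integrable (fun x : E =>
      |C| * (D * (1 + ‖x‖) ^ (-((Module.finrank ℝ E + 1 : ℕ) : ℝ)))) μ :=
    ((integrable_one_add_norm (μ := μ) (by push_cast; linarith)).const_mul D).const_mul |C|
  refine ((lintegral_mono fun x => (hf x).trans ?_).trans_lt hi.lintegral_lt_top).ne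
  refine ENNReal.ofReal_le_ofReal ?_
  refine (mul_le_mul_of_nonneg_right (le_abs_self C) (by positivity)).trans ?_
  exact mul_le_mul_of_nonneg_left (hD _ (norm_nonneg x)) (abs_nonneg C)

/-- Linear change of variables in a Lebesgue integral. -/
theorem lintegral_comp_linearMap {E : Type*} [NormedAddCommGroup E] [NormedSpace ℝ E]
    [FiniteDimensional ℝ E] [MeasurableSpace E] [BorelSpace E] (μ : Measure E)
    [μ.IsAddHaarMeasure] {f : E →ₗ[ℝ] E} (hf : LinearMap.det f ≠ 0) {F : E → ENNReal}
    (hF : Measurable F) :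
    ENNReal.ofReal |LinearMap.det f| * ∫⁻ x, F (f x) ∂μ = ∫⁻ x, F x ∂μ := by
  have hm : Measurable f := f.continuous_of_finiteDimensional.measurable
  rw [← lintegral_map hF hm, Measure.map_linearMap_addHaar_eq_smul_addHaar μ hf,
    lintegral_smul_measure, smul_eq_mul, ← mul_assoc, ← ENNReal.ofReal_mul (abs_nonneg _),
    ← abs_mul, mul_inv_cancel₀ hf]
  simp

end MatrixDirichlet

namespace MatrixDirichlet

variable {d : ℕ}

/-! ### Positive matrices -/

section Positive

open scoped MatrixOrder Matrix.Norms.L2Operator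

/-- Write 1 - K = (1 - ‖K‖)·1 + (‖K‖·1 - K), a positive definite plus a non-negative matrix. -/
theorem posDef_one_sub_of_norm_lt_one {K : Matrix (Fin d) (Fin d) ℂ} (hK : K.IsHermitian)
    (h : ‖K‖ < 1) : (1 - K).PosDef := by
  have h1 : (algebraMap ℝ (Matrix (Fin d) (Fin d) ℂ) ‖K‖ - K).PosSemidef :=
    IsSelfAdjoint.le_algebraMap_norm_self (a := K) hK
  have h2 : ((1 - ‖K‖) • (1 : Matrix (Fin d) (Fin d) ℂ)).PosDef :=
    Matrix.PosDef.one.smul (by linarith)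
  have h3 := h2.add_posSemidef h1
  convert h3 using 1
  rw [Algebra.algebraMap_eq_smul_one, sub_smul, one_smul]
  abel

theorem exists_posDef_one_sub_smul {K : Matrix (Fin d) (Fin d) ℂ} (hK : K.IsHermitian) :
    ∃ ε > 0, ∀ t ∈ Set.Ioo (-ε) ε, (1 - (t : ℝ) • K).PosDef := by
  refine ⟨(‖K‖ + 1)⁻¹, by positivity, fun t ht => posDef_one_sub_of_norm_lt_one ?_ ?_⟩
  · exact IsSelfAdjoint.smul (IsSelfAdjoint.all t) hK
  · rw [norm_smul, Real.norm_eq_abs]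
    have h : |t| < (‖K‖ + 1)⁻¹ := abs_lt.mpr ht
    calc |t| * ‖K‖ ≤ (‖K‖ + 1)⁻¹ * ‖K‖ := by gcongr
      _ < 1 := by rw [inv_mul_lt_iff₀ (by positivity)]; linarith

/-- The cone of non-negative matrices, in coordinates. -/
def cone (d : ℕ) : Set (HermCoord d) := {c | (hermOf c).PosSemidef}

theorem isClosed_cone : IsClosed (cone d) := by
  have h : IsClosed {A : Matrix (Fin d) (Fin d) ℂ | 0 ≤ A} := CStarAlgebra.isClosed_nonneg
  have h' := h.preimage continuous_hermOf
  convert h' using 1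
  ext c
  exact Matrix.nonneg_iff_posSemidef.symm

theorem measurableSet_cone : MeasurableSet (cone d) := isClosed_cone.measurableSet

theorem setOf_posDef_mem_nhds_one :
    {c : HermCoord d | (hermOf c).PosDef} ∈ nhds (coords (1 : Matrix (Fin d) (Fin d) ℂ)) := by
  have hc : Continuous fun c : HermCoord d => ‖1 - hermOf c‖ :=
    (continuous_const.sub continuous_hermOf).norm
  have ho : IsOpen {c : HermCoord d | ‖1 - hermOf c‖ < 1} := isOpen_lt hc continuous_const
  refine Filter.mem_of_superset (ho.mem_nhds ?_) fun c hc => ?_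
  · simp [hermOf_coords Matrix.isHermitian_one]
  · have := posDef_one_sub_of_norm_lt_one
      ((Matrix.isHermitian_one).sub (isHermitian_hermOf c)) hc
    simpa using this

/-- The square root on non-negative matrices has a measurable version. -/
theorem exists_measurable_sqrt (d : ℕ) : ∃ R : HermCoord d → HermCoord d, Measurable R ∧
    ∀ c ∈ cone d, R c ∈ cone d ∧ hermOf (R c) * hermOf (R c) = hermOf c := by
  have : StandardBorelSpace (cone d) := measurableSet_cone.standardBorel
  let f : cone d → HermCoord d := fun c => coords (hermOf c.1 * hermOf c.1)
  have hherm (c : HermCoord d) : (hermOf c * hermOf c).IsHermitian := by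
    simp [Matrix.IsHermitian, (isHermitian_hermOf c).eq]
  have hf : Measurable f := by
    have hc : Continuous fun c : cone d => hermOf c.1 := continuous_hermOf.comp
      continuous_subtype_val
    exact (continuous_coords.comp (hc.mul hc)).measurable
  have hinj : Function.Injective f := by
    intro a b hab
    have h : hermOf a.1 * hermOf a.1 = hermOf b.1 * hermOf b.1 := by
      rw [← hermOf_coords (hherm a.1), ← hermOf_coords (hherm b.1)]
      exact congrArg hermOf hab
    have ha : 0 ≤ hermOf a.1 := a.2.nonneg
    have hb : 0 ≤ hermOf b.1 := b.2.nonneg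
    refine Subtype.ext (hermOf_injective ?_)
    rw [← CFC.sqrt_mul_self (hermOf a.1), ← CFC.sqrt_mul_self (hermOf b.1), h]
  -- Lusin–Souslin: squaring is an injective Borel map on the cone, a standard Borel space, so its
  -- inverse is Borel on the image and extends measurably.
  obtain ⟨R, hR, hRf⟩ := (hf.measurableEmbedding hinj).exists_measurable_extend
    measurable_subtype_coe fun _ => inferInstance
  refine ⟨R, hR, fun c hc => ?_⟩
  have h0 : 0 ≤ hermOf c := Matrix.PosSemidef.nonneg hc
  have hs : (CFC.sqrt (hermOf c)).PosSemidef := (CFC.sqrt_nonneg (hermOf c)).posSemidef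
  let b : cone d := ⟨coords (CFC.sqrt (hermOf c)), by
    simpa [cone, hermOf_coords hs.isHermitian] using hs⟩
  have hb : hermOf b.1 * hermOf b.1 = hermOf c := by
    simp only [b, hermOf_coords hs.isHermitian]
    exact CFC.sqrt_mul_sqrt_self (hermOf c)
  have hfb : f b = c := by
    simp only [f, hb, coords_hermOf]
  have hRc : R c = b.1 := by
    rw [← hfb]
    exact congrFun hRf b
  rw [hRc]
  exact ⟨b.2, hb⟩

theorem exists_conjTranspose_mul_self_of_posDef {A : Matrix (Fin d) (Fin d) ℂ} (hA : A.PosDef) :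
    ∃ T : Matrix (Fin d) (Fin d) ℂ, T.det ≠ 0 ∧ Tᴴ * T = A := by
  obtain ⟨T, hT⟩ := CStarAlgebra.nonneg_iff_eq_star_mul_self.mp hA.posSemidef.nonneg
  refine ⟨T, fun h => hA.det_pos.ne' ?_, hT.symm⟩
  rw [hT, Matrix.det_mul, h, mul_zero]

end Positive

/-! ### Congruence by an invertible matrix -/

theorem posSemidef_conj_iff {T A : Matrix (Fin d) (Fin d) ℂ} (hT : T.det ≠ 0) :
    (T * A * Tᴴ).PosSemidef ↔ A.PosSemidef :=
  Matrix.IsUnit.posSemidef_star_right_conjugate_iff ((Matrix.isUnit_iff_isUnit_det T).mpr hT.isUnit)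

theorem conjL_mem_cone_iff {T : Matrix (Fin d) (Fin d) ℂ} (hT : T.det ≠ 0) (c : HermCoord d) :
    conjL T c ∈ cone d ↔ c ∈ cone d := by
  simp only [cone, Set.mem_ofPred_eq, hermOf_conjL]
  exact posSemidef_conj_iff hT

theorem det_conjL_ne_zero {T : Matrix (Fin d) (Fin d) ℂ} (hT : T.det ≠ 0) :
    LinearMap.det (conjL T) ≠ 0 := by
  rw [← abs_pos, abs_det_conjL]
  have := norm_pos_iff.mpr hT
  positivity

theorem det_re_conj (T A : Matrix (Fin d) (Fin d) ℂ) :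
    (T * A * Tᴴ).det.re = ‖T.det‖ ^ 2 * A.det.re := by
  have h : (T * A * Tᴴ).det = ((‖T.det‖ ^ 2 : ℝ) : ℂ) * A.det := by
    rw [Matrix.det_mul, Matrix.det_mul, Matrix.det_conjTranspose]
    push_cast
    rw [← Complex.mul_conj']
    simp only [starRingEnd_apply]
    ring
  rw [h, Complex.re_ofReal_mul]

/-! ### Wishart weights -/

/-- The density `det(A) ^ r` on the cone of non-negative matrices. -/
noncomputable def coneWeight (r : ℕ) : HermCoord d → ENNReal :=
  (cone d).indicator fun c => ENNReal.ofReal ((hermOf c).det.re ^ r)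

theorem continuous_det_re_hermOf : Continuous fun c : HermCoord d => (hermOf c).det.re :=
  Complex.continuous_re.comp continuous_hermOf.matrix_det

theorem measurable_coneWeight (r : ℕ) : Measurable (coneWeight (d := d) r) := by
  have h : Measurable fun c : HermCoord d => ENNReal.ofReal ((hermOf c).det.re ^ r) :=
    (continuous_det_re_hermOf.measurable.pow_const r).ennreal_ofReal
  exact Measurable.indicator h measurableSet_cone

theorem coneWeight_ne_top (r : ℕ) (c : HermCoord d) : coneWeight r c ≠ ⊤ := by
  unfold coneWeight
  by_cases h : c ∈ cone d <;> simp [h]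

theorem coneWeight_conjL {T : Matrix (Fin d) (Fin d) ℂ} (hT : T.det ≠ 0) (r : ℕ)
    (c : HermCoord d) :
    coneWeight r (conjL T c) = ENNReal.ofReal (‖T.det‖ ^ (2 * r)) * coneWeight r c := by
  unfold coneWeight
  by_cases h : c ∈ cone d
  · rw [Set.indicator_of_mem h, Set.indicator_of_mem ((conjL_mem_cone_iff hT c).mpr h),
      ← ENNReal.ofReal_mul (by positivity), hermOf_conjL, det_re_conj, mul_pow, pow_mul]
  · rw [Set.indicator_of_notMem h,
      Set.indicator_of_notMem (fun h' => h ((conjL_mem_cone_iff hT c).mp h')), mul_zero]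

/-- The exponential weight `exp (- Re tr (Θ A))`. -/
noncomputable def expWeight (Θ : Matrix (Fin d) (Fin d) ℂ) (c : HermCoord d) : ENNReal :=
  ENNReal.ofReal (Real.exp (-(Θ * hermOf c).trace.re))

theorem measurable_expWeight (Θ : Matrix (Fin d) (Fin d) ℂ) : Measurable (expWeight Θ) := by
  have : Continuous fun c : HermCoord d => (Θ * hermOf c).trace.re :=
    Complex.continuous_re.comp (continuous_const.mul continuous_hermOf).matrix_trace
  exact (Real.measurable_exp.comp this.measurable.neg).ennreal_ofReal

theorem expWeight_ne_zero (Θ : Matrix (Fin d) (Fin d) ℂ) (c : HermCoord d) :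
    expWeight Θ c ≠ 0 := by
  simp [expWeight, Real.exp_pos]

theorem expWeight_ne_top (Θ : Matrix (Fin d) (Fin d) ℂ) (c : HermCoord d) :
    expWeight Θ c ≠ ⊤ := ENNReal.ofReal_ne_top

theorem expWeight_one_conjL (T : Matrix (Fin d) (Fin d) ℂ) (c : HermCoord d) :
    expWeight 1 (conjL T c) = expWeight (Tᴴ * T) c := by
  rw [expWeight, expWeight, hermOf_conjL, Matrix.one_mul, Matrix.trace_mul_comm, ← Matrix.mul_assoc]

/-- The coordinates of the Gram matrix `G G*`, where `G` has columns `g j`. -/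
noncomputable def gram {m : Type*} [Fintype m] (g : m → Fin d → ℂ) : HermCoord d :=
  coords ((Matrix.of g)ᵀ * (Matrix.of g)ᵀᴴ)

theorem hermOf_gram {m : Type*} [Fintype m] (g : m → Fin d → ℂ) :
    hermOf (gram g) = (Matrix.of g)ᵀ * (Matrix.of g)ᵀᴴ :=
  hermOf_coords (isHermitian_mul_conjTranspose_self _)

theorem continuous_gram {m : Type*} [Fintype m] : Continuous (gram (d := d) (m := m)) := by
  refine continuous_coords.comp ?_
  have : Continuous fun g : m → Fin d → ℂ => (Matrix.of g)ᵀ :=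
    continuous_matrix fun i j => by simp only [Matrix.transpose_apply, Matrix.of_apply]; fun_prop
  exact this.matrix_mul this.matrix_conjTranspose

theorem gram_colMul {m : Type*} [Fintype m] (T : Matrix (Fin d) (Fin d) ℂ) (g : m → Fin d → ℂ) :
    gram (colMul m T g) = conjL T (gram g) := by
  refine hermOf_injective ?_
  have h : (Matrix.of (colMul m T g))ᵀ = T * (Matrix.of g)ᵀ := by
    ext p j
    rfl
  rw [hermOf_conjL, hermOf_gram, hermOf_gram, h, Matrix.conjTranspose_mul]
  simp only [Matrix.mul_assoc]

end MatrixDirichlet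

namespace MatrixDirichlet

variable {d : ℕ}

/-! ### Lebesgue measure on the coordinate spaces as a Haar measure -/

instance measurableAdd_hermCoord (d : ℕ) : MeasurableAdd (HermCoord d) :=
  ContinuousAdd.measurableAdd

instance isAddHaarMeasure_hermCoord (d : ℕ) : (volume : Measure (HermCoord d)).IsAddHaarMeasure :=
  Measure.prod.instIsAddHaarMeasure _ _

instance isAddHaarMeasure_pi_hermCoord (n d : ℕ) :
    (volume : Measure (Fin n → HermCoord d)).IsAddHaarMeasure :=
  Measure.pi.isAddHaarMeasure _

instance isAddHaarMeasure_columns (m : Type*) [Fintype m] (d : ℕ) :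
    (volume : Measure (m → Fin d → ℂ)).IsAddHaarMeasure :=
  Measure.pi.isAddHaarMeasure _

instance isAddHaarMeasure_pi_columns {n : ℕ} (m : Fin n → Type*) [∀ k, Fintype (m k)] (d : ℕ) :
    (volume : Measure (∀ k, m k → Fin d → ℂ)).IsAddHaarMeasure :=
  Measure.pi.isAddHaarMeasure _

/-! ### The trace pairing and growth on the cone -/

/-- Linear forms on Hermitian matrices are given by the trace pairing. -/
theorem exists_trace_pairing (ℓ : HermCoord d →ₗ[ℝ] ℝ) :
    ∃ H : HermCoord d, ∀ c, ℓ c = (hermOf H * hermOf c).trace.re := by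
  let B : HermCoord d →ₗ[ℝ] HermCoord d →ₗ[ℝ] ℝ :=
    LinearMap.mk₂ ℝ (fun a b => (hermL d a * hermL d b).trace.re)
      (fun a b c => by simp [add_mul]) (fun r a b => by simp)
      (fun a b c => by simp [mul_add]) (fun r a b => by simp)
  -- The pairing is nondegenerate, since tr(A A*) = 0 forces A = 0; equality of dimensions then
  -- gives surjectivity onto the dual.
  have hinj : Function.Injective B := by
    rw [injective_iff_map_eq_zero]
    intro a ha
    have h1 : (hermOf a * (hermOf a)ᴴ).trace.re = 0 := by
      rw [(isHermitian_hermOf a).eq]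
      exact LinearMap.congr_fun ha a
    have h2 : 0 ≤ (hermOf a * (hermOf a)ᴴ).trace :=
      (Matrix.posSemidef_self_mul_conjTranspose (hermOf a)).trace_nonneg
    have h3 : (hermOf a * (hermOf a)ᴴ).trace = 0 :=
      Complex.ext h1 (Complex.nonneg_iff.mp h2).2.symm
    rw [Matrix.trace_mul_conjTranspose_self_eq_zero_iff] at h3
    exact hermOf_injective (h3.trans (map_zero (hermL d)).symm)
  have hsurj : Function.Surjective B :=
    (LinearMap.injective_iff_surjective_of_finrank_eq_finrank
      (Subspace.dual_finrank_eq (K := ℝ) (V := HermCoord d)).symm).mp hinj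
  obtain ⟨H, hH⟩ := hsurj ℓ
  exact ⟨H, fun c => by rw [← hH]; rfl⟩

/-- With A = B*B, the entry is a product of two columns of B, and 2xy ≤ x² + y² bounds it by the
mean of two squared column norms, each at most the trace. -/
theorem norm_apply_le_trace_of_posSemidef {A : Matrix (Fin d) (Fin d) ℂ} (hA : A.PosSemidef)
    (p q : Fin d) : ‖A p q‖ ≤ A.trace.re := by
  open scoped MatrixOrder in
  obtain ⟨B, rfl⟩ := CStarAlgebra.nonneg_iff_eq_star_mul_self.mp hA.nonneg
  have htr : (star B * B).trace.re = ∑ p, ∑ k, ‖B k p‖ ^ 2 := by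
    simp only [Matrix.trace, Matrix.diag_apply, Matrix.mul_apply, Matrix.star_apply,
      Complex.re_sum]
    refine Finset.sum_congr rfl fun p _ => Finset.sum_congr rfl fun k _ => ?_
    rw [← Complex.normSq_eq_norm_sq, Complex.star_def, ← Complex.normSq_eq_conj_mul_self,
      Complex.ofReal_re]
  have hcol (p : Fin d) : ∑ k, ‖B k p‖ ^ 2 ≤ (star B * B).trace.re := by
    rw [htr]
    exact Finset.single_le_sum (f := fun p => ∑ k, ‖B k p‖ ^ 2)
      (fun _ _ => Finset.sum_nonneg fun _ _ => by positivity) (Finset.mem_univ p)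
  calc ‖(star B * B) p q‖ ≤ ∑ k, ‖B k p‖ * ‖B k q‖ := by
        rw [Matrix.mul_apply]
        refine (norm_sum_le _ _).trans (le_of_eq ?_)
        exact Finset.sum_congr rfl fun k _ => by simp [Matrix.star_apply]
    _ ≤ ∑ k, (‖B k p‖ ^ 2 + ‖B k q‖ ^ 2) / 2 :=
        Finset.sum_le_sum fun k _ => by nlinarith [sq_nonneg (‖B k p‖ - ‖B k q‖)]
    _ = (∑ k, ‖B k p‖ ^ 2 + ∑ k, ‖B k q‖ ^ 2) / 2 := by
        rw [← Finset.sum_div, Finset.sum_add_distrib]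
    _ ≤ (star B * B).trace.re := by linarith [hcol p, hcol q]

theorem norm_le_trace_of_mem_cone {c : HermCoord d} (hc : c ∈ cone d) :
    ‖c‖ ≤ (hermOf c).trace.re := by
  have h0 : 0 ≤ (hermOf c).trace.re :=
    (Complex.nonneg_iff.mp (Matrix.PosSemidef.trace_nonneg hc)).1
  have h := norm_apply_le_trace_of_posSemidef hc
  rw [norm_prod_le_iff, pi_norm_le_iff_of_nonneg h0, pi_norm_le_iff_of_nonneg h0]
  refine ⟨fun p => ?_, fun pq => ?_⟩
  · simpa [hermOf] using h p p
  · simpa [hermOf, pq.2] using h pq.1.1 pq.1.2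

theorem norm_hermOf_apply_le (c : HermCoord d) (p q : Fin d) : ‖hermOf c p q‖ ≤ ‖c‖ := by
  simp only [hermOf, Matrix.of_apply]
  split_ifs with h1 h2
  · exact (norm_le_pi_norm c.2 _).trans (norm_snd_le c)
  · rw [norm_star]
    exact (norm_le_pi_norm c.2 _).trans (norm_snd_le c)
  · rw [Complex.norm_real]
    exact (norm_le_pi_norm c.1 _).trans (norm_fst_le c)

theorem abs_det_re_hermOf_le (c : HermCoord d) :
    |(hermOf c).det.re| ≤ d.factorial * (1 + ‖c‖) ^ d := by
  have h := Matrix.det_le (A := hermOf c) (abv := NormedField.toAbsoluteValue ℂ)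
    (x := 1 + ‖c‖) fun p q => (norm_hermOf_apply_le c p q).trans (by linarith)
  rw [Fintype.card_fin, nsmul_eq_mul] at h
  exact (Complex.abs_re_le_norm _).trans h

theorem lintegral_expWeight_mul_coneWeight_ne_top (r : ℕ) :
    ∫⁻ c : HermCoord d, expWeight 1 c * coneWeight r c ≠ ⊤ := by
  refine lintegral_ne_top_of_le_exp_neg_norm (C := (d.factorial : ℝ) ^ r) (a := d * r) _
    fun c => ?_
  by_cases hc : c ∈ cone d
  · rw [coneWeight, Set.indicator_of_mem hc, expWeight, ← ENNReal.ofReal_mul (Real.exp_pos _).le]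
    refine ENNReal.ofReal_le_ofReal ?_
    have h1 : Real.exp (-(1 * hermOf c).trace.re) ≤ Real.exp (-‖c‖) := by
      rw [Matrix.one_mul]
      exact Real.exp_le_exp.mpr (neg_le_neg (norm_le_trace_of_mem_cone hc))
    have h2 : (hermOf c).det.re ^ r ≤ ((d.factorial : ℝ) * (1 + ‖c‖) ^ d) ^ r := by
      refine (le_abs_self _).trans ?_
      rw [abs_pow]
      exact pow_le_pow_left₀ (abs_nonneg _) (abs_det_re_hermOf_le c) r
    calc _ ≤ Real.exp (-‖c‖) * ((d.factorial : ℝ) * (1 + ‖c‖) ^ d) ^ r := by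
          refine (mul_le_mul_of_nonneg_left h2 (Real.exp_pos _).le).trans ?_
          exact mul_le_mul_of_nonneg_right h1 (by positivity)
      _ = _ := by rw [mul_pow, ← pow_mul]; ring
  · simp [coneWeight, hc]

/-- The integrand is positive on the positive definite matrices, which contain a neighbourhood of
the identity. -/
theorem lintegral_expWeight_mul_coneWeight_ne_zero (r : ℕ) :
    ∫⁻ c : HermCoord d, expWeight 1 c * coneWeight r c ≠ 0 := by
  have hm : Measurable fun c : HermCoord d => expWeight 1 c * coneWeight r c :=
    (measurable_expWeight 1).mul (measurable_coneWeight r)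
  rw [← pos_iff_ne_zero, lintegral_pos_iff_support hm]
  refine lt_of_lt_of_le (Measure.measure_pos_of_mem_nhds volume setOf_posDef_mem_nhds_one)
    (measure_mono fun c hc => ?_)
  have h : 0 < (hermOf c).det.re := (Complex.pos_iff.mp (Matrix.PosDef.det_pos hc)).1
  have hc' : c ∈ cone d := Matrix.PosDef.posSemidef hc
  rw [Function.mem_support]
  refine mul_ne_zero (expWeight_ne_zero 1 c) ?_
  rw [coneWeight, Set.indicator_of_mem hc', ne_eq, ENNReal.ofReal_eq_zero, not_le]
  positivity

theorem trace_hermOf_gram {m : Type*} [Fintype m] (g : m → Fin d → ℂ) :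
    (hermOf (gram g)).trace.re = ∑ j, ∑ p, ‖g j p‖ ^ 2 := by
  rw [hermOf_gram, Finset.sum_comm]
  simp only [Matrix.trace, Matrix.diag_apply, Matrix.mul_apply, Matrix.conjTranspose_apply,
    Matrix.transpose_apply, Matrix.of_apply, Complex.re_sum]
  refine Finset.sum_congr rfl fun p _ => Finset.sum_congr rfl fun k _ => ?_
  rw [← Complex.normSq_eq_norm_sq, Complex.star_def, Complex.mul_conj, Complex.ofReal_re]

theorem lintegral_expWeight_gram_ne_top {m : Type*} [Fintype m] :
    ∫⁻ g : m → Fin d → ℂ, expWeight 1 (gram g) ≠ ⊤ := by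
  -- The factor e comes from ‖g‖ ≤ 1 + S, where S is the sum of squared moduli; this follows from x
  -- ≤ x² + 1/4.
  refine lintegral_ne_top_of_le_exp_neg_norm (C := Real.exp 1) (a := 0) _ fun g => ?_
  refine ENNReal.ofReal_le_ofReal ?_
  rw [Matrix.one_mul, trace_hermOf_gram, pow_zero, mul_one, ← Real.exp_add]
  refine Real.exp_le_exp.mpr ?_
  set S := ∑ j, ∑ p, ‖g j p‖ ^ 2 with hS
  have hS0 : 0 ≤ S := Finset.sum_nonneg fun _ _ => Finset.sum_nonneg fun _ _ => by positivity
  have h : ‖g‖ ≤ 1 + S := by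
    rw [pi_norm_le_iff_of_nonneg (by linarith)]
    intro j
    rw [pi_norm_le_iff_of_nonneg (by linarith)]
    intro p
    have h1 : ‖g j p‖ ^ 2 ≤ S :=
      (Finset.single_le_sum (f := fun p => ‖g j p‖ ^ 2) (fun _ _ => by positivity)
        (Finset.mem_univ p)).trans
      (Finset.single_le_sum (f := fun j => ∑ p, ‖g j p‖ ^ 2)
        (fun _ _ => Finset.sum_nonneg fun _ _ => by positivity) (Finset.mem_univ j))
    nlinarith [sq_nonneg (‖g j p‖ - 1 / 2)]
  linarith

/-! ### The law of a complex Gram matrix -/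

theorem lintegral_expWeight_gram_homogeneous {m : Type*} [Fintype m]
    {T : Matrix (Fin d) (Fin d) ℂ} (hT : T.det ≠ 0) :
    ENNReal.ofReal (‖T.det‖ ^ (2 * Fintype.card m)) *
      ∫⁻ g : m → Fin d → ℂ, expWeight (Tᴴ * T) (gram g) =
    ∫⁻ g : m → Fin d → ℂ, expWeight 1 (gram g) := by
  have hdet := det_colMul (q := m) T
  have h0 : LinearMap.det (colMul m T) ≠ 0 := by
    rw [hdet]
    have := norm_pos_iff.mpr hT
    positivity
  have h := lintegral_comp_linearMap (volume : Measure (m → Fin d → ℂ)) h0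
    ((measurable_expWeight (d := d) 1).comp continuous_gram.measurable)
  rw [hdet, abs_of_nonneg (by positivity)] at h
  simpa only [Function.comp_apply, gram_colMul, expWeight_one_conjL] using h

/-- Substituting T A T* for A contributes 2d to the exponent through the Jacobian and 2r through
det^r. For r = m - d the total 2m is the exponent in `lintegral_expWeight_gram_homogeneous`. -/
theorem lintegral_expWeight_coneWeight_homogeneous (r : ℕ)
    {T : Matrix (Fin d) (Fin d) ℂ} (hT : T.det ≠ 0) :
    ENNReal.ofReal (‖T.det‖ ^ (2 * (d + r))) *
      ∫⁻ c : HermCoord d, expWeight (Tᴴ * T) c * coneWeight r c =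
    ∫⁻ c : HermCoord d, expWeight 1 c * coneWeight r c := by
  have h := lintegral_comp_linearMap (volume : Measure (HermCoord d)) (det_conjL_ne_zero hT)
    ((measurable_expWeight (d := d) 1).mul (measurable_coneWeight r))
  simp only [Pi.mul_apply] at h
  rw [← h, abs_det_conjL, mul_add, pow_add, ENNReal.ofReal_mul (by positivity), mul_assoc]
  congr 1
  rw [← lintegral_const_mul' _ _ ENNReal.ofReal_ne_top]
  refine lintegral_congr fun c => ?_
  rw [expWeight_one_conjL, coneWeight_conjL hT]
  ring

/-- The Gram matrix `G G*` of a `d × m` matrix `G` distributed according to Lebesgue measure has a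
density proportional to `det(A) ^ (m - d)` on the cone of non-negative matrices. -/
theorem exists_map_gram_volume {m : Type*} [Fintype m] (hm : d ≤ Fintype.card m) :
    ∃ C : ENNReal, C ≠ ⊤ ∧ (volume : Measure (m → Fin d → ℂ)).map gram =
      volume.withDensity fun c => C * coneWeight (Fintype.card m - d) c := by
  set r := Fintype.card m - d with hr
  have hmr : d + r = Fintype.card m := by omega
  set γ : Measure (HermCoord d) := (volume : Measure (m → Fin d → ℂ)).map gram with hγ
  set c₁ := ∫⁻ c, expWeight 1 c ∂γ with hc₁
  set c₂ := ∫⁻ c : HermCoord d, expWeight 1 c * coneWeight r c with hc₂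
  have hgm : Measurable (gram (d := d) (m := m)) := continuous_gram.measurable
  have hγint (Θ : Matrix (Fin d) (Fin d) ℂ) :
      ∫⁻ c, expWeight Θ c ∂γ = ∫⁻ g : m → Fin d → ℂ, expWeight Θ (gram g) :=
    lintegral_map (measurable_expWeight Θ) hgm
  have hc₁top : c₁ ≠ ⊤ := by
    rw [hc₁, hγint]
    exact lintegral_expWeight_gram_ne_top
  have hc₂top : c₂ ≠ ⊤ := lintegral_expWeight_mul_coneWeight_ne_top r
  have hc₂zero : c₂ ≠ 0 := lintegral_expWeight_mul_coneWeight_ne_zero r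
  have hw₁ : Measurable fun c : HermCoord d => c₂ * expWeight 1 c :=
    (measurable_expWeight 1).const_mul _
  have hw₃ : Measurable fun c : HermCoord d => (c₂ * expWeight 1 c)⁻¹ := hw₁.inv
  have hw₂ : Measurable fun c : HermCoord d => c₁ * (expWeight 1 c * coneWeight r c) :=
    ((measurable_expWeight 1).mul (measurable_coneWeight r)).const_mul _
  -- Writing Θ = T*T, both Laplace transforms at Θ are |det T|^(-2m) times their values c₁ and c₂ at
  -- the identity.
  have key (Θ : Matrix (Fin d) (Fin d) ℂ) (hΘ : Θ.PosDef) :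
      ∫⁻ c, expWeight Θ c ∂γ ≠ ⊤ ∧
      c₂ * ∫⁻ c, expWeight Θ c ∂γ = c₁ * ∫⁻ c, expWeight Θ c * coneWeight r c := by
    obtain ⟨T, hT, rfl⟩ := exists_conjTranspose_mul_self_of_posDef hΘ
    have h1 := lintegral_expWeight_gram_homogeneous (m := m) hT
    have h2 := lintegral_expWeight_coneWeight_homogeneous r hT
    rw [← hγint, ← hγint, ← hc₁] at h1
    rw [hmr, ← hc₂] at h2
    have hJ : ENNReal.ofReal (‖T.det‖ ^ (2 * Fintype.card m)) ≠ 0 := by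
      have := norm_pos_iff.mpr hT
      simp only [ne_eq, ENNReal.ofReal_eq_zero, not_le]
      positivity
    refine ⟨fun htop => hc₁top ?_, ?_⟩
    · rw [← h1, htop, ENNReal.mul_top hJ]
    · rw [← ENNReal.mul_right_inj hJ ENNReal.ofReal_ne_top, mul_left_comm, h1, mul_left_comm, h2,
        mul_comm]
  have hexp (ℓ : HermCoord d →L[ℝ] ℝ) (H : HermCoord d)
      (hH : ∀ c, ℓ c = (hermOf H * hermOf c).trace.re) (t : ℝ) (c : HermCoord d) :
      expWeight 1 c * ENNReal.ofReal (Real.exp (t * ℓ c)) = expWeight (1 - t • hermOf H) c := by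
    rw [expWeight, expWeight, ← ENNReal.ofReal_mul (Real.exp_pos _).le, ← Real.exp_add, hH]
    congr 2
    simp [sub_mul]
    ring
  have hfin₁ : IsFiniteMeasure (γ.withDensity fun c => c₂ * expWeight 1 c) := by
    refine isFiniteMeasure_withDensity ?_
    rw [lintegral_const_mul' _ _ hc₂top]
    exact ENNReal.mul_ne_top hc₂top hc₁top
  have hfin₂ : IsFiniteMeasure ((volume : Measure (HermCoord d)).withDensity
      fun c => c₁ * (expWeight 1 c * coneWeight r c)) := by
    refine isFiniteMeasure_withDensity ?_
    rw [lintegral_const_mul' _ _ hc₁top]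
    exact ENNReal.mul_ne_top hc₁top hc₂top
  have heq : γ.withDensity (fun c => c₂ * expWeight 1 c) =
      volume.withDensity fun c => c₁ * (expWeight 1 c * coneWeight r c) := by
    -- The tilt by exp(-tr A) makes both measures finite. If ℓ is the pairing with H, integrating
    -- exp(tℓ) against them gives the untilted Laplace transforms at 1 - tH, positive definite for
    -- small t, where `key` applies.
    refine measure_ext_of_lintegral_exp_eq fun ℓ => ?_
    obtain ⟨H, hH⟩ := exists_trace_pairing ℓ.toLinearMap
    obtain ⟨ε, hε, hpos⟩ := exists_posDef_one_sub_smul (isHermitian_hermOf H)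
    refine ⟨ε, hε, fun t ht => ?_⟩
    obtain ⟨k1, k2⟩ := key _ (hpos t ht)
    have hmeas : Measurable fun c => ENNReal.ofReal (Real.exp (t * ℓ c)) :=
      (Real.measurable_exp.comp (ℓ.continuous.measurable.const_mul t)).ennreal_ofReal
    have e1 : ∫⁻ c, ENNReal.ofReal (Real.exp (t * ℓ c))
          ∂γ.withDensity (fun c => c₂ * expWeight 1 c) =
        c₂ * ∫⁻ c, expWeight (1 - t • hermOf H) c ∂γ := by
      rw [lintegral_withDensity_eq_lintegral_mul _ hw₁ hmeas, ← lintegral_const_mul' _ _ hc₂top]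
      refine lintegral_congr fun c => ?_
      rw [Pi.mul_apply, mul_assoc, hexp ℓ H hH]
    have e2 : ∫⁻ c, ENNReal.ofReal (Real.exp (t * ℓ c))
          ∂(volume : Measure (HermCoord d)).withDensity
            (fun c => c₁ * (expWeight 1 c * coneWeight r c)) =
        c₁ * ∫⁻ c, expWeight (1 - t • hermOf H) c * coneWeight r c := by
      rw [lintegral_withDensity_eq_lintegral_mul _ hw₂ hmeas, ← lintegral_const_mul' _ _ hc₁top]
      refine lintegral_congr fun c => ?_
      rw [Pi.mul_apply, ← hexp ℓ H hH]
      ring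
    rw [e1, e2]
    exact ⟨ENNReal.mul_ne_top hc₂top k1, k2⟩
  refine ⟨c₂⁻¹ * c₁, ENNReal.mul_ne_top (ENNReal.inv_ne_top.mpr hc₂zero) hc₁top, ?_⟩
  -- The tilting factor is nowhere 0 or ∞, so dividing by it recovers the original measures.
  have hinv : γ = (γ.withDensity fun c => c₂ * expWeight 1 c).withDensity
      fun c => (c₂ * expWeight 1 c)⁻¹ := by
    rw [← withDensity_mul _ hw₁ hw₃]
    have : ((fun c : HermCoord d => c₂ * expWeight 1 c) * fun c => (c₂ * expWeight 1 c)⁻¹) = 1 := by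
      funext c
      exact ENNReal.mul_inv_cancel (mul_ne_zero hc₂zero (expWeight_ne_zero 1 c))
        (ENNReal.mul_ne_top hc₂top (expWeight_ne_top 1 c))
    rw [this, withDensity_one]
  rw [hinv, heq, ← withDensity_mul _ hw₂ hw₃]
  congr 1
  funext c
  rw [Pi.mul_apply, ENNReal.mul_inv (.inl hc₂zero) (.inl hc₂top)]
  have hx := ENNReal.mul_inv_cancel (expWeight_ne_zero 1 c) (expWeight_ne_top 1 c)
  calc c₁ * (expWeight 1 c * coneWeight r c) * (c₂⁻¹ * (expWeight 1 c)⁻¹)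
      = c₂⁻¹ * c₁ * coneWeight r c * (expWeight 1 c * (expWeight 1 c)⁻¹) := by ring
    _ = c₂⁻¹ * c₁ * coneWeight r c := by rw [hx, mul_one]

end MatrixDirichlet

namespace MatrixDirichlet

variable {n d : ℕ}

instance borelSpace_pi_hermCoord (n d : ℕ) : BorelSpace (Fin n → HermCoord d) :=
  Pi.borelSpace

instance borelSpace_prod_hermCoord (n d : ℕ) :
    BorelSpace (HermCoord d × (Fin n → HermCoord d)) :=
  Prod.borelSpace

/-! ### Products of measures with densities -/

theorem lintegral_fin_prod_eq_prod {n : ℕ} {α : Fin n → Type*} [∀ i, MeasurableSpace (α i)]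
    (μ : ∀ i, Measure (α i)) [∀ i, SigmaFinite (μ i)] {f : ∀ i, α i → ENNReal}
    (hf : ∀ i, Measurable (f i)) :
    ∫⁻ x, ∏ i, f i (x i) ∂Measure.pi μ = ∏ i, ∫⁻ x, f i x ∂μ i := by
  induction n with
  | zero => simp
  | succ n ih =>
    have hmp := (measurePreserving_piFinSuccAbove μ 0).symm
    rw [← hmp.lintegral_comp_emb (MeasurableEquiv.measurableEmbedding _)]
    have hpt : ∀ p : α 0 × (∀ j : Fin n, α ((0 : Fin (n + 1)).succAbove j)),
        ∏ i, f i ((MeasurableEquiv.piFinSuccAbove α 0).symm p i) =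
          f 0 p.1 * ∏ j : Fin n, f j.succ (p.2 j) := fun p => by
      rw [Fin.prod_univ_succ]
      rfl
    rw [Fin.prod_univ_succ, lintegral_congr hpt]
    have hm : Measurable fun y : ∀ j : Fin n, α j.succ => ∏ j : Fin n, f j.succ (y j) :=
      Finset.measurable_prod _ fun j _ => (hf j.succ).comp (measurable_pi_apply j)
    exact (lintegral_prod_mul (μ := μ 0) (ν := Measure.pi fun j : Fin n => μ j.succ) (hf 0).aemeasurable hm.aemeasurable).trans
      (congrArg _ (ih (fun j => μ j.succ) fun j => hf j.succ))

theorem pi_withDensity {n : ℕ} {α : Fin n → Type*} [∀ i, MeasurableSpace (α i)]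
    (μ : ∀ i, Measure (α i)) [∀ i, SigmaFinite (μ i)] {f : ∀ i, α i → ENNReal}
    (hf : ∀ i, Measurable (f i)) [∀ i, SigmaFinite ((μ i).withDensity (f i))] :
    Measure.pi (fun i => (μ i).withDensity (f i)) =
      (Measure.pi μ).withDensity fun x => ∏ i, f i (x i) := by
  refine (Measure.pi_eq fun s hs => ?_)
  rw [withDensity_apply _ (MeasurableSet.univ_pi hs),
    ← lintegral_indicator (MeasurableSet.univ_pi hs)]
  have h : ∀ x, (Set.univ.pi s).indicator (fun x => ∏ i, f i (x i)) x =
      ∏ i, (s i).indicator (f i) (x i) := by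
    intro x
    by_cases hx : x ∈ Set.univ.pi s
    · rw [Set.indicator_of_mem hx]
      exact Finset.prod_congr rfl fun i _ => (Set.indicator_of_mem (hx i trivial) _).symm
    · rw [Set.indicator_of_notMem hx]
      simp only [Set.mem_univ_pi, not_forall] at hx
      obtain ⟨i, hi⟩ := hx
      exact (Finset.prod_eq_zero (Finset.mem_univ i) (Set.indicator_of_notMem hi _)).symm
  simp_rw [h]
  rw [lintegral_fin_prod_eq_prod μ fun i => (hf i).indicator (hs i)]
  refine Finset.prod_congr rfl fun i _ => ?_
  rw [lintegral_indicator (hs i), withDensity_apply _ (hs i)]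

/-- The joint law of the Gram matrices of independent blocks. -/
theorem exists_lintegral_gram_pi (m : Fin n → Type*) [∀ k, Fintype (m k)]
    (hm : ∀ k, d ≤ Fintype.card (m k)) :
    ∃ C : ENNReal, C ≠ ⊤ ∧ ∀ F : (Fin n → HermCoord d) → ENNReal, Measurable F →
      ∫⁻ g : ∀ k, m k → Fin d → ℂ, F (fun k => gram (g k)) =
        C * ∫⁻ A : Fin n → HermCoord d, F A * ∏ k, coneWeight (Fintype.card (m k) - d) (A k) := by
  choose C hC hmap using fun k => exists_map_gram_volume (hm k)
  have hw (k : Fin n) : Measurable fun c : HermCoord d =>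
      C k * coneWeight (Fintype.card (m k) - d) c := (measurable_coneWeight _).const_mul _
  have hσ (k : Fin n) : SigmaFinite ((volume : Measure (HermCoord d)).withDensity
      fun c => C k * coneWeight (Fintype.card (m k) - d) c) :=
    SigmaFinite.withDensity_of_ne_top
      (.of_forall fun c => ENNReal.mul_ne_top (hC k) (coneWeight_ne_top _ c))
  have hσ' (k : Fin n) :
      SigmaFinite ((volume : Measure (m k → Fin d → ℂ)).map (gram (d := d))) := by
    rw [hmap k]
    exact hσ k
  have hprod : (volume : Measure (∀ k, m k → Fin d → ℂ)).map (fun g k => gram (g k)) =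
      (volume : Measure (Fin n → HermCoord d)).withDensity
        fun A => ∏ k, (C k * coneWeight (Fintype.card (m k) - d) (A k)) := by
    rw [volume_pi, Measure.pi_map_pi fun k => continuous_gram.measurable.aemeasurable]
    simp_rw [hmap]
    exact pi_withDensity _ hw
  have hgm : Measurable fun (g : ∀ k, m k → Fin d → ℂ) k => gram (g k) :=
    measurable_pi_lambda _ fun k => continuous_gram.measurable.comp (measurable_pi_apply k)
  have hCtop : ∏ k, C k ≠ ⊤ := ENNReal.prod_ne_top fun k _ => hC k
  have hwm : Measurable fun A : Fin n → HermCoord d =>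
      ∏ k, (C k * coneWeight (Fintype.card (m k) - d) (A k)) :=
    Finset.measurable_prod _ fun k _ => (hw k).comp (measurable_pi_apply k)
  refine ⟨∏ k, C k, hCtop, fun F hF => ?_⟩
  rw [← lintegral_map hF hgm, hprod, lintegral_withDensity_eq_lintegral_mul _ hwm hF,
    ← lintegral_const_mul' _ _ hCtop]
  refine lintegral_congr fun A => ?_
  rw [Pi.mul_apply, Finset.prod_mul_distrib]
  ring

/-! ### Changes of variables -/

/-- Translation invariance in the last variable lets the total S replace it, so that S can then be
held fixed. -/
theorem lintegral_fin_succ_eq_lintegral_sum {F : (Fin (n + 1) → HermCoord d) → ENNReal}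
    (hF : Measurable F) :
    ∫⁻ A, F A = ∫⁻ S : HermCoord d, ∫⁻ Z : Fin n → HermCoord d, F (Fin.snoc Z (S - ∑ k, Z k)) := by
  have hmp := (volume_preserving_piFinSuccAbove (fun _ : Fin (n + 1) => HermCoord d)
    (Fin.last n)).symm
  have hsnoc : Measurable fun p : HermCoord d × (Fin n → HermCoord d) =>
      (Fin.snoc p.2 p.1 : Fin (n + 1) → HermCoord d) := by
    refine measurable_pi_lambda _ fun k => ?_
    refine Fin.lastCases ?_ (fun k => ?_) k
    · simpa using measurable_fst
    · simp only [Fin.snoc_castSucc]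
      exact (measurable_pi_apply k).comp measurable_snd
  have hshear : Measurable fun p : HermCoord d × (Fin n → HermCoord d) =>
      (p.1 - ∑ k, p.2 k, p.2) := by
    refine Continuous.measurable ?_
    fun_prop
  calc ∫⁻ A, F A = ∫⁻ p : HermCoord d × (Fin n → HermCoord d), F (Fin.snoc p.2 p.1) := by
        rw [← hmp.lintegral_comp_emb (MeasurableEquiv.measurableEmbedding _)]
        refine lintegral_congr fun p => congrArg F ?_
        simp [MeasurableEquiv.piFinSuccAbove_symm_apply, Fin.insertNthEquiv, Fin.insertNth_last']
    _ = ∫⁻ Z : Fin n → HermCoord d, ∫⁻ S : HermCoord d, F (Fin.snoc Z S) :=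
        lintegral_prod_symm' _ (hF.comp hsnoc)
    _ = ∫⁻ Z : Fin n → HermCoord d, ∫⁻ S : HermCoord d, F (Fin.snoc Z (S - ∑ k, Z k)) :=
        lintegral_congr fun Z =>
          (lintegral_sub_right_eq_self (fun S => F (Fin.snoc Z S)) (∑ k, Z k)).symm
    _ = _ := lintegral_lintegral_swap
        (f := fun Z S => F (Fin.snoc Z (S - ∑ k, Z k)))
        ((hF.comp (hsnoc.comp hshear)).comp measurable_swap).aemeasurable

/-- The simultaneous action `A ↦ T A T*` on tuples. -/
noncomputable def conjPi (n : ℕ) (T : Matrix (Fin d) (Fin d) ℂ) :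
    (Fin n → HermCoord d) →ₗ[ℝ] (Fin n → HermCoord d) :=
  LinearMap.pi fun k => (conjL T).comp (LinearMap.proj k)

theorem abs_det_conjPi (T : Matrix (Fin d) (Fin d) ℂ) :
    |LinearMap.det (conjPi n T)| = (‖T.det‖ ^ (2 * d)) ^ n := by
  rw [conjPi, LinearMap.det_pi, Finset.prod_const, Finset.card_univ, Fintype.card_fin, abs_pow,
    abs_det_conjL]

/-- Positive definite exponential weight: `exp (- tr S)` on positive definite `S`, and zero
elsewhere. -/
noncomputable def posDefWeight : HermCoord d → ENNReal :=
  {c | (hermOf c).PosDef}.indicator (expWeight 1)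

/-- A closed set intersected with an open one, hence Borel. -/
theorem setOf_posDef_eq : {c : HermCoord d | (hermOf c).PosDef} =
    cone d ∩ {c | (hermOf c).det ≠ 0} := by
  ext c
  exact ⟨fun h => ⟨Matrix.PosDef.posSemidef h, (Matrix.PosDef.det_pos h).ne'⟩,
    fun h => (Matrix.PosSemidef.posDef_iff_det_ne_zero h.1).mpr h.2⟩

theorem measurable_posDefWeight : Measurable (posDefWeight (d := d)) := by
  refine (measurable_expWeight 1).indicator ?_
  rw [setOf_posDef_eq]
  exact measurableSet_cone.inter
    (isOpen_ne_fun continuous_hermOf.matrix_det continuous_const).measurableSet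

/-! ### Measurability of matrix operations and of the normalized blocks -/

theorem measurable_matrix_mul {α p q r : Type*} [MeasurableSpace α] [Fintype q]
    {f : α → Matrix p q ℂ} {g : α → Matrix q r ℂ} (hf : Measurable f) (hg : Measurable g) :
    Measurable fun x => f x * g x := by
  refine measurable_pi_lambda _ fun i => measurable_pi_lambda _ fun j => ?_
  simp only [Matrix.mul_apply]
  exact Finset.measurable_sum _ fun k _ =>
    ((measurable_pi_apply k).comp ((measurable_pi_apply i).comp hf)).mul
      ((measurable_pi_apply j).comp ((measurable_pi_apply k).comp hg))

theorem measurable_matrix_conjTranspose {p q : Type*} :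
    Measurable fun A : Matrix p q ℂ => Aᴴ := by
  refine measurable_pi_lambda _ fun i => measurable_pi_lambda _ fun j => ?_
  exact Complex.continuous_conj.measurable.comp
    ((measurable_pi_apply i).comp (measurable_pi_apply j))

/-- The adjugate formula also holds at singular matrices, where both sides are 0 by convention. -/
theorem measurable_matrix_inv : Measurable fun A : Matrix (Fin d) (Fin d) ℂ => A⁻¹ := by
  have h : (fun A : Matrix (Fin d) (Fin d) ℂ => A⁻¹) = fun A => A.det⁻¹ • A.adjugate := by
    funext A
    rw [Matrix.inv_def, Ring.inverse_eq_inv']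
  rw [h]
  refine measurable_pi_lambda _ fun i => measurable_pi_lambda _ fun j => ?_
  have h1 : Measurable fun A : Matrix (Fin d) (Fin d) ℂ => A.det :=
    (continuous_id.matrix_det).measurable
  have h2 : Measurable fun A : Matrix (Fin d) (Fin d) ℂ => A.adjugate i j :=
    ((continuous_id.matrix_adjugate).matrix_elem i j).measurable
  exact h1.inv.mul h2

/-- Given a square root `R`, the normalized blocks `S^{-1/2} A_k S^{-1/2}`, with `S = ∑ A_k`. -/
noncomputable def normalizedBlocks (R : HermCoord d → HermCoord d) (A : Fin (n + 1) → HermCoord d) :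
    Fin n → Matrix (Fin d) (Fin d) ℂ :=
  fun k => (hermOf (R (∑ i, A i)))⁻¹ * hermOf (A k.castSucc) * ((hermOf (R (∑ i, A i)))⁻¹)ᴴ

theorem measurable_normalizedBlocks {R : HermCoord d → HermCoord d} (hR : Measurable R) :
    Measurable (normalizedBlocks (n := n) R) := by
  have hsum : Measurable fun A : Fin (n + 1) → HermCoord d => ∑ i, A i := by
    refine Continuous.measurable ?_
    fun_prop
  have hinv : Measurable fun A : Fin (n + 1) → HermCoord d => (hermOf (R (∑ i, A i)))⁻¹ :=
    measurable_matrix_inv.comp (continuous_hermOf.measurable.comp (hR.comp hsum))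
  refine measurable_pi_lambda _ fun k => ?_
  exact measurable_matrix_mul (measurable_matrix_mul hinv
    (continuous_hermOf.measurable.comp (measurable_pi_apply _)))
    (measurable_matrix_conjTranspose.comp hinv)

/-- Separation of the sum `S` from the normalized blocks. -/
theorem exists_lintegral_normalizedBlocks {R : HermCoord d → HermCoord d} (hR : Measurable R)
    (hsq : ∀ c ∈ cone d, R c ∈ cone d ∧ hermOf (R c) * hermOf (R c) = hermOf c)
    (r : Fin (n + 1) → ℕ) :
    ∃ C : ENNReal, ∀ h : (Fin n → Matrix (Fin d) (Fin d) ℂ) → ENNReal, Measurable h →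
      ∫⁻ A : Fin (n + 1) → HermCoord d,
          posDefWeight (∑ k, A k) * h (normalizedBlocks R A) * ∏ k, coneWeight (r k) (A k) =
        C * ∫⁻ Z : Fin n → HermCoord d, h (fun k => hermOf (Z k)) *
          ((∏ k, coneWeight (r k.castSucc) (Z k)) *
            coneWeight (r (Fin.last n)) (coords 1 - ∑ k, Z k)) := by
  -- With T = S^{1/2}, the first factor is the Jacobian of Z ↦ T Z T* on n-tuples; the product
  -- collects the powers of |det T| released by all n + 1 weights.
  let J : HermCoord d → ENNReal := fun S =>
    ENNReal.ofReal ((‖(hermOf (R S)).det‖ ^ (2 * d)) ^ n) *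
      ∏ k, ENNReal.ofReal (‖(hermOf (R S)).det‖ ^ (2 * r k))
  have hJ : Measurable J := by
    have h1 : Measurable fun S => ‖(hermOf (R S)).det‖ :=
      (continuous_hermOf.matrix_det.norm).measurable.comp hR
    exact ((h1.pow_const _).pow_const _).ennreal_ofReal.mul
      (Finset.measurable_prod _ fun k _ => (h1.pow_const _).ennreal_ofReal)
  refine ⟨∫⁻ S : HermCoord d, posDefWeight S * J S, fun h hh => ?_⟩
  set D := ∫⁻ Z : Fin n → HermCoord d, h (fun k => hermOf (Z k)) *
    ((∏ k, coneWeight (r k.castSucc) (Z k)) *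
      coneWeight (r (Fin.last n)) (coords 1 - ∑ k, Z k)) with hD
  have hsum : Measurable fun A : Fin (n + 1) → HermCoord d => ∑ i, A i := by
    refine Continuous.measurable ?_
    fun_prop
  have hΦ : Measurable fun A : Fin (n + 1) → HermCoord d =>
      posDefWeight (∑ k, A k) * h (normalizedBlocks R A) * ∏ k, coneWeight (r k) (A k) :=
    ((measurable_posDefWeight.comp hsum).mul (hh.comp (measurable_normalizedBlocks hR))).mul
      (Finset.measurable_prod _ fun k _ => (measurable_coneWeight _).comp (measurable_pi_apply k))
  have hκJ : Measurable fun S => posDefWeight S * J S := measurable_posDefWeight.mul hJ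
  rw [lintegral_fin_succ_eq_lintegral_sum hΦ,
    ← lintegral_mul_const _ hκJ]
  refine lintegral_congr fun S => ?_
  have hsumS (Z : Fin n → HermCoord d) :
      ∑ k, (Fin.snoc Z (S - ∑ k, Z k) : Fin (n + 1) → HermCoord d) k = S := by
    rw [Fin.sum_univ_castSucc]
    simp
  by_cases hS : (hermOf S).PosDef
  swap
  · have h0 : posDefWeight S = 0 :=
      Set.indicator_of_notMem (s := {c | (hermOf c).PosDef}) hS _
    simp only [hsumS, h0, zero_mul, lintegral_zero]
  obtain ⟨hRS, hRR⟩ := hsq S hS.posSemidef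
  set T := hermOf (R S) with hT
  have hTT : T * Tᴴ = hermOf S := by rw [hT, (isHermitian_hermOf (R S)).eq, hRR]
  have hdet : T.det ≠ 0 := by
    intro h0
    refine hS.det_pos.ne' ?_
    rw [← hTT, Matrix.det_mul, h0, zero_mul]
  -- As S = T·1·T*, the last block S - ∑ T Z_k T* equals T (1 - ∑ Z_k) T*, so its weight scales like
  -- the others.
  have hS1 : conjL T (coords 1) = S := by
    refine hermOf_injective ?_
    rw [hermOf_conjL, hermOf_coords Matrix.isHermitian_one, Matrix.mul_one, hTT]
  have hdetPi : LinearMap.det (conjPi n T) ≠ 0 := by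
    rw [← abs_pos, abs_det_conjPi]
    have := norm_pos_iff.mpr hdet
    positivity
  have hsnoc : Measurable fun Z : Fin n → HermCoord d =>
      (Fin.snoc Z (S - ∑ k, Z k) : Fin (n + 1) → HermCoord d) := by
    refine measurable_pi_lambda _ fun k => ?_
    refine Fin.lastCases ?_ (fun k => ?_) k
    · simp only [Fin.snoc_last]
      refine Continuous.measurable ?_
      fun_prop
    · simpa using measurable_pi_apply k
  refine (lintegral_comp_linearMap volume hdetPi (hΦ.comp hsnoc)).symm.trans ?_
  rw [abs_det_conjPi]
  have hpt (Z : Fin n → HermCoord d) :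
      posDefWeight (∑ k, (Fin.snoc (conjPi n T Z) (S - ∑ k, conjPi n T Z k) :
          Fin (n + 1) → HermCoord d) k) *
        h (normalizedBlocks R (Fin.snoc (conjPi n T Z) (S - ∑ k, conjPi n T Z k))) *
        ∏ k, coneWeight (r k) ((Fin.snoc (conjPi n T Z) (S - ∑ k, conjPi n T Z k) :
          Fin (n + 1) → HermCoord d) k) =
      (posDefWeight S * ∏ k, ENNReal.ofReal (‖T.det‖ ^ (2 * r k))) *
        (h (fun k => hermOf (Z k)) * ((∏ k, coneWeight (r k.castSucc) (Z k)) *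
          coneWeight (r (Fin.last n)) (coords 1 - ∑ k, Z k))) := by
    have h1 : normalizedBlocks R (Fin.snoc (conjPi n T Z) (S - ∑ k, conjPi n T Z k)) =
        fun k => hermOf (Z k) := by
      funext k
      rw [normalizedBlocks, hsumS, Fin.snoc_castSucc, ← hT]
      have hu : IsUnit T.det := hdet.isUnit
      change T⁻¹ * hermOf (conjL T (Z k)) * (T⁻¹)ᴴ = hermOf (Z k)
      rw [hermOf_conjL, Matrix.mul_assoc T, Matrix.nonsing_inv_mul_cancel_left _ _ hu,
        Matrix.mul_assoc, ← Matrix.conjTranspose_mul, Matrix.nonsing_inv_mul _ hu,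
        Matrix.conjTranspose_one, Matrix.mul_one]
    have h2 : S - ∑ k, conjPi n T Z k = conjL T (coords 1 - ∑ k, Z k) := by
      rw [map_sub, hS1, map_sum]
      rfl
    rw [hsumS, h1, Fin.prod_univ_castSucc, Fin.prod_univ_castSucc]
    simp only [Fin.snoc_castSucc, Fin.snoc_last]
    rw [h2, coneWeight_conjL hdet]
    have h3 : ∏ k : Fin n, coneWeight (r k.castSucc) (conjPi n T Z k) =
        (∏ k : Fin n, ENNReal.ofReal (‖T.det‖ ^ (2 * r k.castSucc))) *
          ∏ k : Fin n, coneWeight (r k.castSucc) (Z k) := by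
      rw [← Finset.prod_mul_distrib]
      exact Finset.prod_congr rfl fun k _ => coneWeight_conjL hdet _ _
    rw [h3]
    ring
  have hfin : posDefWeight S * ∏ k, ENNReal.ofReal (‖T.det‖ ^ (2 * r k)) ≠ ⊤ := by
    refine ENNReal.mul_ne_top ?_ (ENNReal.prod_ne_top fun k _ => ENNReal.ofReal_ne_top)
    rw [posDefWeight, Set.indicator_of_mem (show S ∈ {c | (hermOf c).PosDef} from hS)]
    exact expWeight_ne_top 1 S
  simp only [Function.comp_apply, hpt]
  rw [lintegral_const_mul' _ _ hfin, ← hD]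
  simp only [J, ← hT]
  ring

/-! ### Integrals against the Dirichlet measure -/

theorem measurable_matrix_elem {α p q : Type*} [MeasurableSpace α] {f : α → Matrix p q ℂ}
    (hf : Measurable f) (i : p) (j : q) : Measurable fun x => f x i j :=
  (measurable_pi_apply j).comp ((measurable_pi_apply i).comp hf)

theorem measurable_one_sub_sum :
    Measurable fun Z : Fin n → Matrix (Fin d) (Fin d) ℂ => 1 - ∑ k, Z k := by
  refine measurable_pi_lambda _ fun i => measurable_pi_lambda _ fun j => ?_
  simp only [Matrix.sub_apply, Matrix.sum_apply]
  have h (k : Fin n) : Measurable fun Z : Fin n → Matrix (Fin d) (Fin d) ℂ => Z k i j :=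
    measurable_matrix_elem (measurable_pi_apply k) i j
  exact (Finset.measurable_sum _ fun k _ => h k).const_sub _

theorem measurableSet_matrixSimplex : MeasurableSet (matrixSimplex n d) := by
  open scoped MatrixOrder Matrix.Norms.L2Operator in
  have h : IsClosed {A : Matrix (Fin d) (Fin d) ℂ | A.PosSemidef} := by
    have := CStarAlgebra.isClosed_nonneg (A := Matrix (Fin d) (Fin d) ℂ)
    simpa only [Matrix.nonneg_iff_posSemidef] using this
  have hm : MeasurableSet {A : Matrix (Fin d) (Fin d) ℂ | A.PosSemidef} := h.measurableSet
  have h1 : MeasurableSet {Z : Fin n → Matrix (Fin d) (Fin d) ℂ | ∀ k, (Z k).PosSemidef} := by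
    have : {Z : Fin n → Matrix (Fin d) (Fin d) ℂ | ∀ k, (Z k).PosSemidef} =
        ⋂ k, (fun Z => Z k) ⁻¹' {A | A.PosSemidef} := by
      ext Z
      simp
    rw [this]
    exact MeasurableSet.iInter fun k => measurable_pi_apply k hm
  exact h1.inter (measurable_one_sub_sum hm)

theorem measurable_dirichletWeight (a : Fin (n + 1) → ℝ) :
    Measurable (dirichletWeight (n := n) (d := d) a) := by
  have hd : Measurable fun A : Matrix (Fin d) (Fin d) ℂ => A.det.re :=
    (Complex.continuous_re.comp continuous_id.matrix_det).measurable
  exact (Finset.measurable_prod _ fun k _ => (hd.comp (measurable_pi_apply k)).pow_const _).mul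
    ((hd.comp measurable_one_sub_sum).pow_const _)

theorem coneWeight_of_mem (r : ℕ) {c : HermCoord d} (hc : c ∈ cone d) :
    coneWeight r c = ENNReal.ofReal ((hermOf c).det.re ^ r) :=
  Set.indicator_of_mem hc _

/-- The indicator of the simplex is the product of the n + 1 cone indicators inside the weights, and
the exponents a_k - 1 = r_k are natural numbers. -/
theorem lintegral_dirichletUnnormalized (r : Fin (n + 1) → ℕ)
    {h : (Fin n → Matrix (Fin d) (Fin d) ℂ) → ENNReal} (hh : Measurable h) :
    ∫⁻ Z, h Z ∂dirichletUnnormalized n d (fun k => (r k : ℝ) + 1) =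
      ∫⁻ Z : Fin n → HermCoord d, h (fun k => hermOf (Z k)) *
        ((∏ k, coneWeight (r k.castSucc) (Z k)) *
          coneWeight (r (Fin.last n)) (coords 1 - ∑ k, Z k)) := by
  have hw : Measurable fun Z : Fin n → Matrix (Fin d) (Fin d) ℂ =>
      ENNReal.ofReal (dirichletWeight (fun k => (r k : ℝ) + 1) Z) :=
    (measurable_dirichletWeight _).ennreal_ofReal
  have hφ : Measurable fun (c : Fin n → HermCoord d) k => hermOf (c k) :=
    measurable_pi_lambda _ fun k => continuous_hermOf.measurable.comp (measurable_pi_apply k)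
  rw [dirichletUnnormalized, lintegral_withDensity_eq_lintegral_mul _ hw hh,
    ← lintegral_indicator measurableSet_matrixSimplex, hermLebesgue,
    lintegral_map ((hw.mul hh).indicator measurableSet_matrixSimplex) hφ]
  refine lintegral_congr fun Z => ?_
  have hlast : (1 : Matrix (Fin d) (Fin d) ℂ) - ∑ k, hermOf (Z k) =
      hermOf (coords 1 - ∑ k, Z k) := by
    rw [← hermL_apply, map_sub, map_sum, hermL_apply, hermOf_coords Matrix.isHermitian_one]
    rfl
  have hmem : (fun k => hermOf (Z k)) ∈ matrixSimplex n d ↔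
      (∀ k, Z k ∈ cone d) ∧ coords 1 - ∑ k, Z k ∈ cone d := by
    rw [matrixSimplex, Set.mem_ofPred_eq, hlast]
    rfl
  by_cases hZ : (fun k => hermOf (Z k)) ∈ matrixSimplex n d
  · rw [Set.indicator_of_mem hZ]
    obtain ⟨hZ1, hZ2⟩ := hmem.mp hZ
    have hnn (k : Fin n) : 0 ≤ (hermOf (Z k)).det.re ^ r k.castSucc :=
      pow_nonneg (Complex.nonneg_iff.mp (Matrix.PosSemidef.det_nonneg (hZ1 k))).1 _
    have e : ENNReal.ofReal (dirichletWeight (fun k => (r k : ℝ) + 1) fun k => hermOf (Z k)) =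
        (∏ k, coneWeight (r k.castSucc) (Z k)) *
          coneWeight (r (Fin.last n)) (coords 1 - ∑ k, Z k) := by
      simp only [dirichletWeight, hlast, add_sub_cancel_right, Real.rpow_natCast]
      rw [ENNReal.ofReal_mul (Finset.prod_nonneg fun k _ => hnn k),
        ENNReal.ofReal_prod_of_nonneg fun k _ => hnn k]
      congr 1
      · exact Finset.prod_congr rfl fun k _ => (coneWeight_of_mem _ (hZ1 k)).symm
      · exact (coneWeight_of_mem _ hZ2).symm
    rw [Pi.mul_apply, e, mul_comm]
  · rw [Set.indicator_of_notMem hZ]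
    rw [hmem, not_and_or, not_forall] at hZ
    rcases hZ with ⟨k, hk⟩ | hk
    · have : coneWeight (r k.castSucc) (Z k) = 0 := Set.indicator_of_notMem hk _
      rw [Finset.prod_eq_zero (Finset.mem_univ k) this, zero_mul, mul_zero]
    · have : coneWeight (r (Fin.last n)) (coords 1 - ∑ k, Z k) = 0 := Set.indicator_of_notMem hk _
      rw [this, mul_zero, mul_zero]

end MatrixDirichlet

namespace MatrixDirichlet

variable {n d N : ℕ}

/-! ### Completing orthonormal rows to a special unitary matrix -/

theorem exists_unitary_extension (hdN : d ≤ N) {W : Matrix (Fin d) (Fin N) ℂ} (hW : W * Wᴴ = 1) :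
    ∃ U : Matrix (Fin N) (Fin N) ℂ, U * Uᴴ = 1 ∧ U.submatrix (Fin.castLE hdN) id = W := by
  -- The rows past d are filled with a dummy 0; orthonormality is required only of the first d.
  let v : Fin N → EuclideanSpace ℂ (Fin N) := fun i =>
    if h : i.1 < d then WithLp.toLp 2 (W ⟨i, h⟩) else 0
  have hv : Orthonormal ℂ (({i : Fin N | i.1 < d} : Set (Fin N)).domRestrict v) := by
    rw [orthonormal_iff_ite]
    rintro ⟨i, hi⟩ ⟨j, hj⟩
    have hi' : i.1 < d := hi
    have hj' : j.1 < d := hj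
    have h := congrFun (congrFun hW ⟨j, hj'⟩) ⟨i, hi'⟩
    rw [Matrix.mul_apply] at h
    simp only [Set.domRestrict_apply, v, hi', hj', dif_pos, PiLp.inner_apply, RCLike.inner_apply]
    refine Eq.trans ?_ (h.trans ?_)
    · exact Finset.sum_congr rfl fun c _ => by simp [Matrix.conjTranspose_apply]
    · rw [Matrix.one_apply]
      simp only [Subtype.mk.injEq, Fin.ext_iff]
      simp only [eq_comm]
  obtain ⟨b, hb⟩ := hv.exists_orthonormalBasis_extension_of_card_eq
    (by simp : Module.finrank ℂ (EuclideanSpace ℂ (Fin N)) = Fintype.card (Fin N))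
  refine ⟨Matrix.of fun i c => b i c, ?_, ?_⟩
  · ext i j
    have h := orthonormal_iff_ite.mp b.orthonormal j i
    rw [PiLp.inner_apply] at h
    rw [Matrix.mul_apply, Matrix.one_apply]
    simp only [eq_comm (a := i), ← h]
    exact Finset.sum_congr rfl fun c _ => by
      simp [Matrix.conjTranspose_apply, RCLike.inner_apply]
  · ext p c
    have h := hb (Fin.castLE hdN p) p.2
    simp [h, v]

/-- A unitary completion is corrected by multiplying row d, the first one outside W, by the
conjugate of its determinant. Such a spare row exists because d < N. -/
theorem exists_specialUnitary_extension (hdN : d < N) {W : Matrix (Fin d) (Fin N) ℂ}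
    (hW : W * Wᴴ = 1) :
    ∃ v : SU N, (v : Matrix (Fin N) (Fin N) ℂ).submatrix (Fin.castLE hdN.le) id = W := by
  obtain ⟨U, hU, hUW⟩ := exists_unitary_extension hdN.le hW
  let D : Fin N → ℂ := Function.update 1 ⟨d, hdN⟩ (star U.det)
  have hdet : star U.det * U.det = 1 := by
    have h := congrArg Matrix.det hU
    rwa [Matrix.det_mul, Matrix.det_conjTranspose, Matrix.det_one, mul_comm] at h
  have hD : ∀ i, D i * star (D i) = 1 := by
    intro i
    by_cases hi : i = ⟨d, hdN⟩
    · subst hi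
      simpa [D] using hdet
    · simp [D, Function.update_of_ne hi]
  refine ⟨⟨Matrix.diagonal D * U, mem_specialUnitaryGroup_iff.mpr
    ⟨mem_unitaryGroup_iff.mpr ?_, ?_⟩⟩, ?_⟩
  · rw [Matrix.star_eq_conjTranspose, Matrix.conjTranspose_mul, Matrix.mul_assoc,
      ← Matrix.mul_assoc U, hU, Matrix.one_mul, Matrix.diagonal_conjTranspose,
      Matrix.diagonal_mul_diagonal, ← Matrix.diagonal_one]
    congr 1
    funext i
    exact hD i
  · rw [Matrix.det_mul, Matrix.det_diagonal, Finset.prod_update_of_mem (Finset.mem_univ _)]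
    simpa using hdet
  · rw [← hUW]
    ext p c
    have hp : Fin.castLE hdN.le p ≠ ⟨d, hdN⟩ := by
      intro h
      exact p.2.ne (congrArg Fin.val h)
    simp [D, Matrix.diagonal_mul, Function.update_of_ne hp]

/-! ### Blocks of columns -/

/-- The matrices `W⁽ᵏ⁾ W⁽ᵏ⁾*` of the blocks of columns of a `d × N` matrix, without the last. -/
noncomputable def blockGrams (I : Fin (n + 1) → Finset (Fin N)) (M : Matrix (Fin d) (Fin N) ℂ) :
    Fin n → Matrix (Fin d) (Fin d) ℂ :=
  fun k => M.submatrix id (Subtype.val : I k.castSucc → Fin N) *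
    (M.submatrix id (Subtype.val : I k.castSucc → Fin N))ᴴ

theorem extract_eq_blockGrams (hdN : d ≤ N) (I : Fin (n + 1) → Finset (Fin N)) (u : SU N) :
    extract hdN I u =
      blockGrams I ((u : Matrix (Fin N) (Fin N) ℂ).submatrix (Fin.castLE hdN) id) := rfl

theorem measurable_blockGrams (I : Fin (n + 1) → Finset (Fin N)) :
    Measurable (blockGrams (d := d) I) := by
  refine measurable_pi_lambda _ fun k => ?_
  have h : Measurable fun M : Matrix (Fin d) (Fin N) ℂ =>
      M.submatrix id (Subtype.val : I k.castSucc → Fin N) :=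
    measurable_pi_lambda _ fun p => measurable_pi_lambda _ fun j =>
      measurable_matrix_elem measurable_id p j.1
  exact measurable_matrix_mul h (measurable_matrix_conjTranspose.comp h)

theorem measurable_extract (hdN : d ≤ N) (I : Fin (n + 1) → Finset (Fin N)) :
    Measurable (extract hdN I) := by
  have h : Measurable fun u : SU N =>
      (u : Matrix (Fin N) (Fin N) ℂ).submatrix (Fin.castLE hdN) id :=
    measurable_pi_lambda _ fun p => measurable_pi_lambda _ fun j =>
      measurable_matrix_elem (f := fun u : SU N => (u : Matrix (Fin N) (Fin N) ℂ))
        measurable_subtype_coe (Fin.castLE hdN p) j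
  have h' := (measurable_blockGrams I).comp h
  exact h'

instance isHaarMeasure_haarSU (N : ℕ) : (haarSU N).IsHaarMeasure :=
  Measure.isHaarMeasure_haarMeasure _

instance isProbabilityMeasure_haarSU (N : ℕ) : IsProbabilityMeasure (haarSU N) :=
  ⟨Measure.haarMeasure_self⟩

/-- Orthonormal rows multiplied by a Haar distributed special unitary matrix. -/
theorem lintegral_blockGrams_mul (hdN : d ≤ N) (I : Fin (n + 1) → Finset (Fin N))
    (hn : n = 0 ∨ d = 0 ∨ d < N) {W : Matrix (Fin d) (Fin N) ℂ} (hW : W * Wᴴ = 1)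
    (h : (Fin n → Matrix (Fin d) (Fin d) ℂ) → ENNReal) :
    ∫⁻ u : SU N, h (blockGrams I (W * (u : Matrix (Fin N) (Fin N) ℂ))) ∂haarSU N =
      ∫⁻ u, h (extract hdN I u) ∂haarSU N := by
  rcases hn with rfl | hn
  · exact lintegral_congr fun u => congrArg h (Subsingleton.elim _ _)
  obtain ⟨v, hv⟩ : ∃ v : SU N,
      (v : Matrix (Fin N) (Fin N) ℂ).submatrix (Fin.castLE hdN) id = W := by
    rcases hn with rfl | hlt
    · exact ⟨1, Subsingleton.elim _ _⟩
    · exact exists_specialUnitary_extension hlt hW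
  -- Left invariance of Haar measure: the first d rows of v u are W u.
  rw [← lintegral_mul_left_eq_self (fun u => h (extract hdN I u)) v]
  refine lintegral_congr fun u => congrArg h ?_
  rw [extract_eq_blockGrams, ← hv]
  rfl

/-- Column indices, sorted by blocks. -/
noncomputable def blockEquiv (I : Fin (n + 1) → Finset (Fin N))
    (hdisj : Pairwise fun i j => Disjoint (I i) (I j)) (hcover : ∀ c : Fin N, ∃ i, c ∈ I i) :
    (Σ k, I k) ≃ Fin N :=
  Equiv.ofBijective (fun s => s.2.1) <| by
    refine ⟨?_, fun c => ?_⟩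
    · rintro ⟨k, j, hj⟩ ⟨l, i, hi⟩ h
      obtain rfl : j = i := h
      obtain rfl : k = l := by
        by_contra hkl
        exact Finset.disjoint_left.mp (hdisj hkl) hj hi
      rfl
    · obtain ⟨i, hi⟩ := hcover c
      exact ⟨⟨i, c, hi⟩, rfl⟩

theorem sum_card_blocks {I : Fin (n + 1) → Finset (Fin N)}
    (hdisj : Pairwise fun i j => Disjoint (I i) (I j)) (hcover : ∀ c : Fin N, ∃ i, c ∈ I i) :
    ∑ k, (I k).card = N := by
  have h := Fintype.card_congr (blockEquiv I hdisj hcover)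
  simpa using h

/-- The matrix assembled from blocks of columns. -/
noncomputable def assemble (d : ℕ) (I : Fin (n + 1) → Finset (Fin N))
    (hdisj : Pairwise fun i j => Disjoint (I i) (I j)) (hcover : ∀ c : Fin N, ∃ i, c ∈ I i) :
    (∀ k, I k → Fin d → ℂ) ≃ₗ[ℝ] Matrix (Fin d) (Fin N) ℂ where
  toFun g := Matrix.of fun p c =>
    g ((blockEquiv I hdisj hcover).symm c).1 ((blockEquiv I hdisj hcover).symm c).2 p
  map_add' _ _ := rfl
  map_smul' _ _ := rfl
  invFun M := fun _ j p => M p j.1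
  left_inv g := by
    funext k j p
    have h : (blockEquiv I hdisj hcover).symm j.1 = ⟨k, j⟩ :=
      (Equiv.symm_apply_eq _).mpr rfl
    exact congrArg (fun s : Σ k, I k => g s.1 s.2 p) h
  right_inv M := by
    ext p c
    exact congrArg (M p) ((blockEquiv I hdisj hcover).apply_symm_apply c)

section Blocks

variable {I : Fin (n + 1) → Finset (Fin N)}

theorem assemble_apply_coe (hdisj : Pairwise fun i j => Disjoint (I i) (I j))
    (hcover : ∀ c : Fin N, ∃ i, c ∈ I i)
    (g : ∀ k, I k → Fin d → ℂ) (p : Fin d) (k : Fin (n + 1)) (j : I k) :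
    assemble d I hdisj hcover g p j.1 = g k j p :=
  congrFun (congrFun (congrFun ((assemble d I hdisj hcover).symm_apply_apply g) k) j) p

theorem measurable_assemble (hdisj : Pairwise fun i j => Disjoint (I i) (I j))
    (hcover : ∀ c : Fin N, ∃ i, c ∈ I i) : Measurable (assemble d I hdisj hcover) :=
  measurable_pi_lambda _ fun p => measurable_pi_lambda _ fun _ =>
    (measurable_pi_apply p).comp ((measurable_pi_apply _).comp (measurable_pi_apply _))

theorem continuous_assemble (hdisj : Pairwise fun i j => Disjoint (I i) (I j))
    (hcover : ∀ c : Fin N, ∃ i, c ∈ I i) : Continuous (assemble d I hdisj hcover) :=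
  continuous_matrix fun p _ =>
    (continuous_apply p).comp ((continuous_apply _).comp (continuous_apply _))

theorem hermOf_gram_block (hdisj : Pairwise fun i j => Disjoint (I i) (I j))
    (hcover : ∀ c : Fin N, ∃ i, c ∈ I i)
    (g : ∀ k, I k → Fin d → ℂ) (k : Fin (n + 1)) :
    hermOf (gram (g k)) =
      (assemble d I hdisj hcover g).submatrix id (Subtype.val : I k → Fin N) *
        ((assemble d I hdisj hcover g).submatrix id (Subtype.val : I k → Fin N))ᴴ := by
  have h : (Matrix.of (g k))ᵀ =
      (assemble d I hdisj hcover g).submatrix id (Subtype.val : I k → Fin N) := by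
    ext p j
    exact (assemble_apply_coe hdisj hcover g p k j).symm
  rw [hermOf_gram, h]

/-- In each entry of G G*, the sum over columns is regrouped by blocks. -/
theorem hermOf_sum_gram (hdisj : Pairwise fun i j => Disjoint (I i) (I j))
    (hcover : ∀ c : Fin N, ∃ i, c ∈ I i)
    (g : ∀ k, I k → Fin d → ℂ) :
    hermOf (∑ k, gram (g k)) =
      assemble d I hdisj hcover g * (assemble d I hdisj hcover g)ᴴ := by
  rw [← hermL_apply, map_sum]
  simp only [hermL_apply, hermOf_gram_block hdisj hcover]
  ext p q
  rw [Matrix.sum_apply, Matrix.mul_apply, ← (blockEquiv I hdisj hcover).sum_comp,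
    Fintype.sum_sigma]
  rfl

theorem sum_gram_eq (hdisj : Pairwise fun i j => Disjoint (I i) (I j))
    (hcover : ∀ c : Fin N, ∃ i, c ∈ I i)
    (g : ∀ k, I k → Fin d → ℂ) :
    ∑ k, gram (g k) = coords (assemble d I hdisj hcover g * (assemble d I hdisj hcover g)ᴴ) := by
  rw [← hermOf_sum_gram, coords_hermOf]

theorem normalizedBlocks_gram (hdisj : Pairwise fun i j => Disjoint (I i) (I j))
    (hcover : ∀ c : Fin N, ∃ i, c ∈ I i)
    (R : HermCoord d → HermCoord d) (g : ∀ k, I k → Fin d → ℂ) :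
    normalizedBlocks R (fun k => gram (g k)) =
      blockGrams I ((hermOf (R (∑ k, gram (g k))))⁻¹ * assemble d I hdisj hcover g) := by
  funext k
  rw [normalizedBlocks, blockGrams, hermOf_gram_block hdisj hcover g]
  set T := (hermOf (R (∑ k, gram (g k))))⁻¹
  have h : (T * assemble d I hdisj hcover g).submatrix id
      (Subtype.val : I k.castSucc → Fin N) =
      T * (assemble d I hdisj hcover g).submatrix id Subtype.val := rfl
  rw [h, Matrix.conjTranspose_mul]
  simp only [Matrix.mul_assoc]

/-- The Jacobian of right multiplication by u is a power of |det u| = 1. -/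
theorem lintegral_assemble_mul (hdisj : Pairwise fun i j => Disjoint (I i) (I j))
    (hcover : ∀ c : Fin N, ∃ i, c ∈ I i)
    (u : SU N) {Ψ : Matrix (Fin d) (Fin N) ℂ → ENNReal}
    (hΨ : Measurable Ψ) :
    ∫⁻ g, Ψ (assemble d I hdisj hcover g * (u : Matrix (Fin N) (Fin N) ℂ)) =
      ∫⁻ g, Ψ (assemble d I hdisj hcover g) := by
  let e := assemble d I hdisj hcover
  let f : (∀ k, I k → Fin d → ℂ) →ₗ[ℝ] (∀ k, I k → Fin d → ℂ) :=
    e.symm.toLinearMap ∘ₗ mulRightR (Fin d) (u : Matrix (Fin N) (Fin N) ℂ) ∘ₗ e.toLinearMap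
  have hdet : LinearMap.det f = 1 := by
    have h := LinearMap.det_conj (mulRightR (Fin d) (u : Matrix (Fin N) (Fin N) ℂ)) e.symm
    rw [det_mulRightR, (mem_specialUnitaryGroup_iff.mp u.2).2] at h
    simpa [f] using h
  have h := lintegral_comp_linearMap volume (f := f) (by rw [hdet]; exact one_ne_zero)
    (hΨ.comp (measurable_assemble hdisj hcover))
  rw [hdet, abs_one, ENNReal.ofReal_one, one_mul] at h
  refine Eq.trans (lintegral_congr fun g => congrArg Ψ ?_) h
  exact (e.apply_symm_apply _).symm

/-- The weight is at most exp(-tr ∑ A_k), a product of integrable Gaussian factors, one per block.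
-/
theorem lintegral_posDefWeight_ne_top :
    ∫⁻ g : ∀ k, I k → Fin d → ℂ, posDefWeight (∑ k, gram (g k)) ≠ ⊤ := by
  have hle (g : ∀ k, I k → Fin d → ℂ) :
      posDefWeight (∑ k, gram (g k)) ≤ ∏ k, expWeight 1 (gram (g k)) := by
    refine (Set.indicator_le_self _ _ _).trans (le_of_eq ?_)
    unfold expWeight
    rw [← ENNReal.ofReal_prod_of_nonneg fun k _ => (Real.exp_pos _).le, ← Real.exp_sum,
      ← hermL_apply, map_sum]
    simp [hermL_apply, Matrix.trace_sum, Finset.sum_neg_distrib]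
  refine ((lintegral_mono hle).trans_lt ?_).ne
  rw [volume_pi, lintegral_fin_prod_eq_prod
    (fun k => (volume : Measure (I k → Fin d → ℂ))) (f := fun _ g => expWeight 1 (gram g))
    fun k => (measurable_expWeight 1).comp continuous_gram.measurable]
  exact ENNReal.prod_lt_top fun k _ => lintegral_expWeight_gram_ne_top.lt_top

/-- The weight is positive on the open set where G G* is invertible, and this set contains the first
d rows of the identity. -/
theorem lintegral_posDefWeight_ne_zero (hdisj : Pairwise fun i j => Disjoint (I i) (I j))
    (hcover : ∀ c : Fin N, ∃ i, c ∈ I i)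
    (hdN : d ≤ N) :
    ∫⁻ g : ∀ k, I k → Fin d → ℂ, posDefWeight (∑ k, gram (g k)) ≠ 0 := by
  have hgm : Measurable fun g : ∀ k, I k → Fin d → ℂ => posDefWeight (∑ k, gram (g k)) := by
    refine measurable_posDefWeight.comp (Finset.measurable_sum _ fun k _ => ?_)
    exact continuous_gram.measurable.comp (measurable_pi_apply k)
  let e := assemble d I hdisj hcover
  have hopen : IsOpen {g : ∀ k, I k → Fin d → ℂ | (e g * (e g)ᴴ).det ≠ 0} := by
    have hc : Continuous e := continuous_assemble hdisj hcover
    exact isOpen_ne_fun (hc.matrix_mul hc.matrix_conjTranspose).matrix_det continuous_const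
  let M₀ : Matrix (Fin d) (Fin N) ℂ :=
    (1 : Matrix (Fin N) (Fin N) ℂ).submatrix (Fin.castLE hdN) id
  have hM₀ : M₀ * M₀ᴴ = 1 := by
    rw [Matrix.conjTranspose_submatrix, Matrix.conjTranspose_one,
      ← Matrix.submatrix_mul _ _ _ id _ Function.bijective_id, Matrix.one_mul,
      Matrix.submatrix_one _ (Fin.castLE_injective hdN)]
  have hne : {g : ∀ k, I k → Fin d → ℂ | (e g * (e g)ᴴ).det ≠ 0}.Nonempty :=
    ⟨e.symm M₀, by simp [hM₀]⟩
  rw [← pos_iff_ne_zero, lintegral_pos_iff_support hgm]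
  refine (hopen.measure_pos volume hne).trans_le (measure_mono fun g hg => ?_)
  have hpd : (hermOf (∑ k, gram (g k))).PosDef := by
    rw [hermOf_sum_gram hdisj hcover]
    exact (Matrix.PosSemidef.posDef_iff_det_ne_zero
      (Matrix.posSemidef_self_mul_conjTranspose _)).mpr hg
  rw [Function.mem_support, posDefWeight,
    Set.indicator_of_mem (show _ ∈ {c : HermCoord d | (hermOf c).PosDef} from hpd)]
  exact expWeight_ne_zero 1 _

/-- The normalized blocks of a Lebesgue distributed matrix have the law of the extracted blocks
of a Haar distributed special unitary matrix. -/
theorem lintegral_normalizedBlocks_gram (hdisj : Pairwise fun i j => Disjoint (I i) (I j))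
    (hcover : ∀ c : Fin N, ∃ i, c ∈ I i)
    (hdN : d ≤ N) (hn : n = 0 ∨ d = 0 ∨ d < N)
    {R : HermCoord d → HermCoord d} (hR : Measurable R)
    (hsq : ∀ c ∈ cone d, R c ∈ cone d ∧ hermOf (R c) * hermOf (R c) = hermOf c)
    {h : (Fin n → Matrix (Fin d) (Fin d) ℂ) → ENNReal} (hh : Measurable h) :
    ∫⁻ g : ∀ k, I k → Fin d → ℂ, posDefWeight (∑ k, gram (g k)) *
        h (normalizedBlocks R fun k => gram (g k)) =
      (∫⁻ g : ∀ k, I k → Fin d → ℂ, posDefWeight (∑ k, gram (g k))) *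
        ∫⁻ u, h (extract hdN I u) ∂haarSU N := by
  let Ψ : Matrix (Fin d) (Fin N) ℂ → ENNReal := fun M =>
    posDefWeight (coords (M * Mᴴ)) * h (blockGrams I ((hermOf (R (coords (M * Mᴴ))))⁻¹ * M))
  have hS : Measurable fun M : Matrix (Fin d) (Fin N) ℂ => coords (M * Mᴴ) :=
    continuous_coords.measurable.comp
      (measurable_matrix_mul measurable_id measurable_matrix_conjTranspose)
  have hΨ : Measurable Ψ := by
    refine (measurable_posDefWeight.comp hS).mul (hh.comp ((measurable_blockGrams I).comp ?_))
    exact measurable_matrix_mul (measurable_matrix_inv.comp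
      (continuous_hermOf.measurable.comp (hR.comp hS))) measurable_id
  have hgm : Measurable fun g : ∀ k, I k → Fin d → ℂ => posDefWeight (∑ k, gram (g k)) := by
    refine measurable_posDefWeight.comp (Finset.measurable_sum _ fun k _ => ?_)
    exact continuous_gram.measurable.comp (measurable_pi_apply k)
  have hjoint : Measurable (Function.uncurry fun (u : SU N) (g : ∀ k, I k → Fin d → ℂ) =>
      Ψ (assemble d I hdisj hcover g * (u : Matrix (Fin N) (Fin N) ℂ))) :=
    hΨ.comp (measurable_matrix_mul ((measurable_assemble hdisj hcover).comp measurable_snd)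
      (measurable_subtype_coe.comp measurable_fst))
  calc ∫⁻ g : ∀ k, I k → Fin d → ℂ, posDefWeight (∑ k, gram (g k)) *
        h (normalizedBlocks R fun k => gram (g k))
      = ∫⁻ g, Ψ (assemble d I hdisj hcover g) := by
        refine lintegral_congr fun g => ?_
        rw [normalizedBlocks_gram hdisj hcover, sum_gram_eq hdisj hcover]
    -- The inner integral does not depend on u, and Haar measure has mass 1.
    _ = ∫⁻ u : SU N, (∫⁻ g,
          Ψ (assemble d I hdisj hcover g * (u : Matrix (Fin N) (Fin N) ℂ))) ∂haarSU N := by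
        simp_rw [lintegral_assemble_mul hdisj hcover _ hΨ]
        simp
    _ = ∫⁻ g, ∫⁻ u : SU N,
          Ψ (assemble d I hdisj hcover g * (u : Matrix (Fin N) (Fin N) ℂ)) ∂haarSU N :=
        lintegral_lintegral_swap hjoint.aemeasurable
    _ = ∫⁻ g : ∀ k, I k → Fin d → ℂ, posDefWeight (∑ k, gram (g k)) *
          ∫⁻ u, h (extract hdN I u) ∂haarSU N := by
        refine lintegral_congr fun g => ?_
        set M := assemble d I hdisj hcover g with hM
        have hMu (u : SU N) : (M * (u : Matrix (Fin N) (Fin N) ℂ)) *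
            (M * (u : Matrix (Fin N) (Fin N) ℂ))ᴴ = M * Mᴴ := by
          have hu : (u : Matrix (Fin N) (Fin N) ℂ) * (u : Matrix (Fin N) (Fin N) ℂ)ᴴ = 1 :=
            mem_unitaryGroup_iff.mp (mem_specialUnitaryGroup_iff.mp u.2).1
          rw [Matrix.conjTranspose_mul, Matrix.mul_assoc, ← Matrix.mul_assoc _ _ Mᴴ, hu,
            Matrix.one_mul]
        have hsum := sum_gram_eq hdisj hcover g
        rw [← hM] at hsum
        simp only [Ψ, hMu, ← hsum]
        by_cases hpd : (hermOf (∑ k, gram (g k))).PosDef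
        swap
        · have h0 : posDefWeight (∑ k, gram (g k)) = 0 :=
            Set.indicator_of_notMem (s := {c | (hermOf c).PosDef}) hpd _
          simp [h0]
        have hfin : posDefWeight (∑ k, gram (g k)) ≠ ⊤ := by
          rw [posDefWeight,
            Set.indicator_of_mem (show _ ∈ {c : HermCoord d | (hermOf c).PosDef} from hpd)]
          exact expWeight_ne_top 1 _
        rw [lintegral_const_mul' _ _ hfin]
        congr 1
        obtain ⟨-, hRR⟩ := hsq _ hpd.posSemidef
        have hTT := hRR.trans (hermOf_sum_gram hdisj hcover g)
        rw [← hM] at hTT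
        have hT := isHermitian_hermOf (R (∑ k, gram (g k)))
        set T := hermOf (R (∑ k, gram (g k)))
        have hu : IsUnit T.det := by
          refine isUnit_iff_ne_zero.mpr fun h0 => hpd.det_pos.ne' ?_
          rw [← hRR, Matrix.det_mul, h0, zero_mul]
        -- T² = M M* with T Hermitian, so T⁻¹ M has orthonormal rows, and only its product with u
        -- still varies.
        have hW : (T⁻¹ * M) * (T⁻¹ * M)ᴴ = 1 := by
          rw [Matrix.conjTranspose_mul, Matrix.mul_assoc, ← Matrix.mul_assoc M, ← hTT,
            Matrix.mul_assoc T, Matrix.nonsing_inv_mul_cancel_left _ _ hu,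
            Matrix.conjTranspose_nonsing_inv, hT.eq, Matrix.mul_nonsing_inv _ hu]
        have := lintegral_blockGrams_mul hdN I hn hW h
        simpa only [Matrix.mul_assoc] using this
    _ = _ := lintegral_mul_const _ hgm

end Blocks

end MatrixDirichlet

/-! ### Comparison of the two evaluations -/

theorem mainTheorem7 (n d N : ℕ) (hdN : d ≤ N) (I : Fin (n + 1) → Finset (Fin N))
    (hdisj : Pairwise fun i j => Disjoint (I i) (I j))
    (hcover : ∀ c : Fin N, ∃ i, c ∈ I i)
    (hcard : ∀ i, d ≤ (I i).card) :
    IsProbabilityMeasure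
        (MatrixDirichlet.dirichlet n d fun i => ((I i).card : ℝ) - (d : ℝ) + 1) ∧
      MeasureTheory.Measure.map (MatrixDirichlet.extract hdN I) (MatrixDirichlet.haarSU N) =
        MatrixDirichlet.dirichlet n d fun i => ((I i).card : ℝ) - (d : ℝ) + 1 := by
  open MatrixDirichlet in
  -- If n and d are both positive, then N ≥ (n + 1) d ≥ 2d > d. This leaves the spare row needed to
  -- adjust the determinant; for n = 0 or d = 0 no adjustment is needed.
  have hn : n = 0 ∨ d = 0 ∨ d < N := by
    by_contra! hcon
    obtain ⟨h1, h2, h3⟩ := hcon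
    have hsum := sum_card_blocks hdisj hcover
    have hle : ∑ _k : Fin (n + 1), d ≤ ∑ k, (I k).card := Finset.sum_le_sum fun k _ => hcard k
    rw [Finset.sum_const, Finset.card_univ, Fintype.card_fin, smul_eq_mul, hsum] at hle
    have : 2 * d ≤ (n + 1) * d := Nat.mul_le_mul_right d (by omega)
    omega
  obtain ⟨R, hR, hsq⟩ := exists_measurable_sqrt d
  let r : Fin (n + 1) → ℕ := fun k => (I k).card - d
  have ha : (fun i => ((I i).card : ℝ) - (d : ℝ) + 1) = fun i => (r i : ℝ) + 1 := by
    funext i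
    rw [Nat.cast_sub (hcard i)]
  rw [ha]
  obtain ⟨C₁, -, hC₁⟩ := exists_lintegral_gram_pi (d := d) (fun k => I k)
    fun k => by simpa using hcard k
  obtain ⟨C₂, hC₂⟩ := exists_lintegral_normalizedBlocks hR hsq r
  set K := ∫⁻ g : ∀ k, I k → Fin d → ℂ, posDefWeight (∑ k, gram (g k)) with hK
  have hK0 : K ≠ 0 := lintegral_posDefWeight_ne_zero hdisj hcover hdN
  have hKtop : K ≠ ⊤ := lintegral_posDefWeight_ne_top
  set D := dirichletUnnormalized n d fun i => (r i : ℝ) + 1 with hD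
  set ν := Measure.map (extract hdN I) (haarSU N) with hν
  have hem := measurable_extract hdN I
  have hνprob : IsProbabilityMeasure ν := Measure.isProbabilityMeasure_map hem.aemeasurable
  -- Both sides integrate h to the weighted Gaussian-type integral over G, evaluated in the two
  -- ways.
  have key : K • ν = (C₁ * C₂) • D := by
    refine Measure.ext_of_lintegral _ fun h hh => ?_
    have hsum : Measurable fun A : Fin (n + 1) → HermCoord d => ∑ k, A k :=
      Finset.measurable_sum _ fun k _ => measurable_pi_apply k
    have hF : Measurable fun A : Fin (n + 1) → HermCoord d =>
        posDefWeight (∑ k, A k) * h (normalizedBlocks R A) :=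
      (measurable_posDefWeight.comp hsum).mul (hh.comp (measurable_normalizedBlocks hR))
    have e1 := lintegral_normalizedBlocks_gram hdisj hcover hdN hn hR hsq hh
    have e2 := hC₁ _ hF
    simp only [Fintype.card_coe] at e2
    rw [lintegral_smul_measure, lintegral_smul_measure, lintegral_map hh hem, smul_eq_mul,
      smul_eq_mul, ← e1, e2, hC₂ h hh, hD, lintegral_dirichletUnnormalized r hh, mul_assoc]
  -- As ν has mass 1, comparing total masses and using 0 < K < ∞ forces both C₁ C₂ and the Dirichlet
  -- mass to be positive and finite.
  have hmass : K = C₁ * C₂ * D Set.univ := by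
    have h := congrArg (fun μ => μ Set.univ) key
    simpa using h
  have hC0 : C₁ * C₂ ≠ 0 := fun h => hK0 (by rw [hmass, h, zero_mul])
  have hD0 : D Set.univ ≠ 0 := fun h => hK0 (by rw [hmass, h, mul_zero])
  have hCtop : C₁ * C₂ ≠ ⊤ := fun h => hKtop (by rw [hmass, h, ENNReal.top_mul hD0])
  have hDtop : D Set.univ ≠ ⊤ := fun h => hKtop (by rw [hmass, h, ENNReal.mul_top hC0])
  have hνD : ν = dirichlet n d fun i => (r i : ℝ) + 1 := by
    have h1 : ν = K⁻¹ • K • ν := by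
      rw [smul_smul, ENNReal.inv_mul_cancel hK0 hKtop, one_smul]
    rw [h1, key, smul_smul, dirichlet, ← hD, hmass,
      ENNReal.mul_inv (.inl hC0) (.inl hCtop), mul_right_comm, ENNReal.inv_mul_cancel hC0 hCtop,
      one_mul]
  rw [← hνD]
  exact ⟨hνprob, rfl⟩
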